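/- Let $p$ be a prime, $k\ge 2$ an integer, $q=p^k$, let $\mathrm{Tr}$ be the trace from $\mathbb F_q$ to $\mathbb F_p$, with $\mathbb F_p$ identified with $\{0,1,\dots,p-1\}$, and let $\hat{\mathbb F}_q\subset\mathbb F_q$ be the set of primitive roots (generators of $\mathbb F_q^*$), so that $\#\hat{\mathbb F}_q=\varphi(q-1)$ with $\varphi$ Euler's function. For $(\alpha,\beta)\in\mathbb F_q\times\hat{\mathbb F}_q$ and $n\ge 0$ put $$x_n=\sum_{j=1}^{k}\frac{\mathrm{Tr}(\alpha\beta^{kn+j-1})}{p^{j}}\in[0,1),\qquad \mathbf x(n)=(x_n,x_{n+1},\dots,x_{n+s-1})\in[0,1)^s .$$ For points $\mathbf z_0,\dots,\mathbf z_{N-1}\in[0,1)^s$ let $$D((\mathbf z_n)_{n=0}^{N-1})=\sup_{0<\gamma_1,\dots,\gamma_s\le 1}\left|\frac{\#\{0\le n\le N-1:\ \mathbf z_n\in[0,\gamma_1)\times\cdots\times[0,\gamma_s)\}}{N}-\gamma_1\cdots\gamma_s\right| .$$ Theorem. For every integer $s\ge 1$ there are real constants $c_1(s,b_1,b_2)$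 (for positive integers $b_1,b_2$), depending only on $s$, $b_1$ and $b_2$, such that for every prime $p$, every $k\ge 2$, with $q=p^k$, and every $\epsilon\in(0,1)$ there are more than $(1-\epsilon)\,q\,\varphi(q-1)$ pairs $(\alpha,\beta)\in\mathbb F_q\times\hat{\mathbb F}_q$ with the following property: for all integers $N,b_1,b_2\in[1,q]$, $$D\big((\mathbf x(b_1n+b_2))_{n=0}^{N-1}\big)\le \epsilon^{-1}\,c_1(s,b_1,b_2)\,N^{-1/2}\,\big(\ln(6N)\big)^{s+2.5}\,\big(\ln(3\ln(6N))\big)^{2.5}.$$ -/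

import Mathlib

open Classical in
/-- The discrepancy (over boxes `[0, γ₁) × ⋯ × [0, γ_s)` with `0 < γᵢ ≤ 1`) of the first `N` points
of a sequence of points with `s` real coordinates. The set below is nonempty and, for every `N`,
contained in `[0, 1]`, so `sSup` is the true supremum. -/
noncomputable def discrepancy {s : ℕ} (x : ℕ → Fin s → ℝ) (N : ℕ) : ℝ :=
  sSup {d : ℝ | ∃ γ : Fin s → ℝ, (∀ i, 0 < γ i ∧ γ i ≤ 1) ∧
    d = |(((Finset.range N).filter (fun n => ∀ i, x n i ∈ Set.Ico 0 (γ i))).card : ℝ) / (N : ℝ)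
          - ∏ i, γ i|}

/-- The linear recurring sequence `y_n = Tr(α βⁿ) ∈ F_p`, with `Tr` the trace of `F` over `F_p`. -/
noncomputable def shiftRegister (p : ℕ) {F : Type*} [Field F] [Algebra (ZMod p) F]
    (α β : F) (n : ℕ) : ZMod p :=
  Algebra.trace (ZMod p) F (α * β ^ n)

/-- The digital multistep pseudorandom numbers `x_n = ∑_{j=1}^k y_{kn+j-1} / p^j`, where the
elements of `F_p` are represented by the integers `0, …, p - 1`. -/
noncomputable def multistep (p k : ℕ) (y : ℕ → ZMod p) (n : ℕ) : ℝ :=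
  ∑ j ∈ Finset.Icc 1 k, ((y (k * n + j - 1)).val : ℝ) / (p : ℝ) ^ j

/-- The overlapping `s`-tuples `𝐱(n) = (x_n, …, x_{n+s-1})` of a sequence `x`. -/
def overlappingTuple (s : ℕ) (x : ℕ → ℝ) (n : ℕ) : Fin s → ℝ :=
  fun i => x (n + i)

/-! The argument is a second-moment estimate followed by Markov's inequality and a union bound.

For `2 ^ m ≤ N < 2 ^ (m + 1)` only the leading `r + 1` digits of each coordinate are used, at a
resolution of about `2 ^ (-m / 2)`, which costs `O(N ^ (-1/2))`. Boxes are then squeezed between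
products of functions on `((ℤ/p)^(r+1))^s` with controlled Fourier coefficients. This gives an
Erdős–Turán–Koksma inequality, `discrepancy_le`, whose weights sum to at most `(7 (m + 1)) ^ s`.
That bound must involve `log N` and not `log q`. Truncating the digits is not enough for it, since a
single digit may already be too fine when `p` is large, so the last digit used is also smoothed.

By linearity of the trace, the character sum at a frequency `h ≠ 0` is a sum of additive characters
at `α β^(k (b₁ n + b₂)) P_h(β)`, with `P_h` a nonzero polynomial of degree at most `k s`. Averaging
the square over `α` counts coincidences among the powers `β^(k b₁ n)`. They are few because `β` has
order `q - 1`, and the at most `k s` roots of `P_h` are estimated trivially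
(`sum_norm_sq_boxChar_le`). A logarithmic lower bound for Euler's function turns the loss into a
factor `(m + 1)^2` (`moment_factor_le`).

A Rademacher–Menshov decomposition into dyadic blocks makes the estimate uniform in `N` at each
scale `m`, with another factor `(m + 1)^2`. So `√N` times the discrepancy is at most `6 s + √X`,
where `X` has mean `O((m + 1)^(2 s + 4))`. Markov's inequality is applied with failure probabilities
proportional to `1 / ((m + 3) log² (m + 3))` and `1 / (b (b + 1))` for `b = b₁, b₂`. These are
summable, so the exceptional set has proportion at most `ε / 2`, and the constants depend only on
`s, b₁, b₂`. -/

section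

open Finset

/-! ### Functions with dominated Fourier coefficients -/

/-- `f` is a linear combination of the functions `e h` whose coefficients are bounded by `ρ` and
whose coefficient at `0` is `m`. -/
def HasDominatedExpansion {H V : Type*} [Fintype H] [Zero H] (e : H → V → ℂ) (ρ : H → ℝ)
    (f : V → ℝ) (m : ℝ) : Prop :=
  ∃ c : H → ℂ, c 0 = m ∧ (∀ h, ‖c h‖ ≤ ρ h) ∧ ∀ v, (f v : ℂ) = ∑ h, c h * e h v

namespace HasDominatedExpansion

theorem pi {ι : Type*} [Fintype ι] [DecidableEq ι] {H V : Type*} [Fintype H] [Zero H]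
    {e : H → V → ℂ} {ρ : H → ℝ} {f : ι → V → ℝ} {m : ι → ℝ}
    (hf : ∀ i, HasDominatedExpansion e ρ (f i) (m i)) :
    HasDominatedExpansion (fun (h : ι → H) (v : ι → V) => ∏ i, e (h i) (v i))
      (fun h => ∏ i, ρ (h i)) (fun v => ∏ i, f i (v i)) (∏ i, m i) := by
  choose c hc0 hcρ hcf using hf
  refine ⟨fun h => ∏ i, c i (h i), ?_, fun h => ?_, fun v => ?_⟩
  · simp [hc0]
  · rw [norm_prod]
    exact Finset.prod_le_prod (fun _ _ => norm_nonneg _) fun i _ => hcρ i _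
  · push_cast
    simp_rw [hcf, Fintype.prod_sum, ← Finset.prod_mul_distrib]

theorem one {H V : Type*} [Fintype H] [Zero H] {e : H → V → ℂ} {ρ : H → ℝ}
    (h0 : e 0 = 1) (hρ : ∀ h, 0 ≤ ρ h) (hρ0 : 1 ≤ ρ 0) :
    HasDominatedExpansion e ρ (fun _ => 1) 1 := by
  classical
  refine ⟨fun h => if h = 0 then 1 else 0, by simp, fun h => ?_, fun v => by simp [h0]⟩
  dsimp only
  split_ifs with hh
  · simpa [hh] using hρ0
  · simpa using hρ h

theorem one_sub {H V : Type*} [Fintype H] [Zero H] {e : H → V → ℂ} {ρ : H → ℝ}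
    {f : V → ℝ} {m : ℝ} (hf : HasDominatedExpansion e ρ f m) (h0 : e 0 = 1)
    (hρ0 : 1 ≤ ρ 0) (hm : 0 ≤ m) (hm1 : m ≤ 1) :
    HasDominatedExpansion e ρ (fun v => 1 - f v) (1 - m) := by
  classical
  obtain ⟨c, hc0, hcρ, hcf⟩ := hf
  refine ⟨fun h => (if h = 0 then 1 else 0) - c h, by simp [hc0], fun h => ?_, fun v => ?_⟩
  · dsimp only
    split_ifs with hh
    · subst hh
      rw [hc0, ← Complex.ofReal_one, ← Complex.ofReal_sub, Complex.norm_real, Real.norm_eq_abs,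
        abs_of_nonneg (by linarith)]
      linarith
    · simpa using hcρ h
  · simp [sub_mul, Finset.sum_sub_distrib, hcf, h0]

/-- The zero frequency contributes exactly the main term `N * m`; all other frequencies are
estimated termwise. -/
theorem abs_sum_sub_le {H V : Type*} [Fintype H] [Zero H] [DecidableEq H] {e : H → V → ℂ}
    {ρ : H → ℝ} {f : V → ℝ} {m : ℝ} (hf : HasDominatedExpansion e ρ f m) (h0 : e 0 = 1)
    (v : ℕ → V) (N : ℕ) :
    |∑ n ∈ range N, f (v n) - N * m| ≤
      ∑ h ∈ univ.erase 0, ρ h * ‖∑ n ∈ range N, e h (v n)‖ := by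
  obtain ⟨c, hc0, hcρ, hcf⟩ := hf
  have key : ((∑ n ∈ range N, f (v n) - N * m : ℝ) : ℂ) =
      ∑ h ∈ univ.erase 0, c h * ∑ n ∈ range N, e h (v n) := by
    push_cast
    simp_rw [hcf]
    rw [Finset.sum_comm, ← Finset.add_sum_erase _ _ (Finset.mem_univ (0 : H))]
    simp [h0, hc0, Finset.mul_sum]
  rw [← Real.norm_eq_abs, ← Complex.norm_real, key]
  refine (norm_sum_le _ _).trans (Finset.sum_le_sum fun h _ => ?_)
  rw [norm_mul]
  gcongr
  exact hcρ h

end HasDominatedExpansion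

/-! ### Characters of digit blocks and their weights -/

/-- The character of `(ℤ/p)^r` with frequency `h`. -/
noncomputable def digitChar (p : ℕ) [NeZero p] {r : ℕ} (h v : Fin r → ZMod p) : ℂ :=
  ∏ j, ZMod.stdAddChar (h j * v j)

theorem digitChar_zero (p : ℕ) [NeZero p] (r : ℕ) :
    digitChar p (0 : Fin r → ZMod p) = 1 := by
  funext v
  simp [digitChar]

/-- The bound for the Fourier coefficients of smoothed intervals in `ℤ/p`. -/
noncomputable def intervalWeight (p T : ℕ) (h : ZMod p) : ℝ :=
  if h = 0 then 1 else
    -- Each difference equals `T / (h (h + T))`: of size `1 / h` up to `T`, of size `T / h²` beyond.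
    -- Written as a difference, it sums to a harmonic sum of length `T`.
    (1 / (h.val : ℝ) - 1 / ((h.val : ℝ) + T)) +
      (1 / ((p : ℝ) - h.val) - 1 / ((p : ℝ) - h.val + T))

/-- The bound for the Fourier coefficients of smoothed intervals in `(ℤ/p)^(r+1)`, ordered
lexicographically. -/
noncomputable def digitWeight (p T : ℕ) : (r : ℕ) → (Fin (r + 1) → ZMod p) → ℝ
  | 0, h => intervalWeight p T (h 0)
  -- The first summand belongs to the event that the leading digit already decides the comparison,
  -- which involves no tail frequency. The second belongs to equality of leading digits, whose
  -- coefficients all have modulus `1 / p`.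
  | r + 1, h => (if Fin.tail h = 0 then intervalWeight p p (h 0) else 0) +
      (1 / p : ℝ) * digitWeight p T r (Fin.tail h)

theorem intervalWeight_nonneg (p T : ℕ) [NeZero p] (h : ZMod p) : 0 ≤ intervalWeight p T h := by
  unfold intervalWeight
  split_ifs with hh
  · exact zero_le_one
  · have h1 : 0 < h.val := by
      rw [Nat.pos_iff_ne_zero]; simpa using hh
    have h2 : (h.val : ℝ) < p := by exact_mod_cast ZMod.val_lt h
    have h1' : (0 : ℝ) < h.val := by exact_mod_cast h1
    have h3 : (0 : ℝ) < p - h.val := by linarith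
    have hT : (0 : ℝ) ≤ T := by positivity
    have := one_div_le_one_div_of_le h1' (by linarith : (h.val : ℝ) ≤ h.val + T)
    have := one_div_le_one_div_of_le h3 (by linarith : (p : ℝ) - h.val ≤ p - h.val + T)
    linarith

theorem digitWeight_nonneg (p T : ℕ) [NeZero p] :
    ∀ (r : ℕ) (h : Fin (r + 1) → ZMod p), 0 ≤ digitWeight p T r h
  | 0, h => intervalWeight_nonneg p T _
  | r + 1, h => by
    unfold digitWeight
    have := digitWeight_nonneg p T r (Fin.tail h)
    have := intervalWeight_nonneg p p (h 0)
    positivity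

theorem one_le_digitWeight_zero (p T : ℕ) [NeZero p] (r : ℕ) :
    1 ≤ digitWeight p T r 0 := by
  cases r with
  | zero => simp [digitWeight, intervalWeight]
  | succ r =>
    unfold digitWeight
    have := digitWeight_nonneg p T r (Fin.tail (0 : Fin (r + 1 + 1) → ZMod p))
    have ht : Fin.tail (0 : Fin (r + 1 + 1) → ZMod p) = 0 := by funext i; simp [Fin.tail]
    rw [if_pos ht]
    simp [intervalWeight]
    positivity

/-- Shifting by `T` cancels all but a harmonic sum of length `T`, whatever `n` is; hence `log T`
appears instead of `log p`. -/
theorem sum_inv_sub_inv_add_le (n T : ℕ) :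
    ∑ i ∈ range n, (1 / ((i : ℝ) + 1) - 1 / ((i : ℝ) + 1 + T)) ≤
      ∑ i ∈ range T, 1 / ((i : ℝ) + 1) := by
  have h1 : ∑ i ∈ range n, 1 / ((i : ℝ) + 1 + T) =
      ∑ i ∈ range (T + n), 1 / ((i : ℝ) + 1) - ∑ i ∈ range T, 1 / ((i : ℝ) + 1) := by
    rw [Finset.sum_range_add]
    simp only [add_sub_cancel_left]
    refine Finset.sum_congr rfl fun i _ => ?_
    push_cast; ring_nf
  rw [Finset.sum_sub_distrib, h1]
  have : ∑ i ∈ range n, 1 / ((i : ℝ) + 1) ≤ ∑ i ∈ range (T + n), 1 / ((i : ℝ) + 1) :=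
    Finset.sum_le_sum_of_subset_of_nonneg (Finset.range_subset_range.2 (by omega))
      fun i _ _ => by positivity
  linarith

theorem sum_range_inv_le_one_add_log (n : ℕ) :
    ∑ i ∈ range n, 1 / ((i : ℝ) + 1) ≤ 1 + Real.log n := by
  have := harmonic_le_one_add_log n
  rw [harmonic] at this
  push_cast at this
  simpa using this

theorem sum_intervalWeight_le (p T : ℕ) [NeZero p] :
    ∑ h, intervalWeight p T h ≤ 3 + 2 * Real.log T := by
  obtain ⟨q, rfl⟩ : ∃ q, p = q + 1 := ⟨p - 1, by have := NeZero.ne p; omega⟩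
  have h1 : ∑ h : ZMod (q + 1), intervalWeight (q + 1) T h =
      ∑ i ∈ range (q + 1), (if i = 0 then 1 else
        (1 / (i : ℝ) - 1 / ((i : ℝ) + T)) +
          (1 / (((q + 1 : ℕ) : ℝ) - i) - 1 / (((q + 1 : ℕ) : ℝ) - i + T))) := by
    rw [← Fin.sum_univ_eq_sum_range (fun i => (if i = 0 then (1 : ℝ) else
        (1 / (i : ℝ) - 1 / ((i : ℝ) + T)) +
          (1 / (((q + 1 : ℕ) : ℝ) - i) - 1 / (((q + 1 : ℕ) : ℝ) - i + T))))]
    refine Finset.sum_congr rfl fun h _ => ?_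
    unfold intervalWeight
    have : h = 0 ↔ h.val = 0 := by simp
    simp only [this]
    rfl
  rw [h1, Finset.sum_range_succ']
  simp only [Nat.add_eq_zero_iff, one_ne_zero, and_false, if_false, if_true,
    Finset.sum_add_distrib]
  have h2 := sum_inv_sub_inv_add_le q T
  have h3 : ∑ i ∈ range q, (1 / (((q + 1 : ℕ) : ℝ) - ((i + 1 : ℕ) : ℝ)) -
      1 / (((q + 1 : ℕ) : ℝ) - ((i + 1 : ℕ) : ℝ) + T)) =
      ∑ i ∈ range q, (1 / ((i : ℝ) + 1) - 1 / ((i : ℝ) + 1 + T)) := by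
    rw [← Finset.sum_range_reflect]
    refine Finset.sum_congr rfl fun i hi => ?_
    have hi := Finset.mem_range.1 hi
    have : ((q - 1 - i : ℕ) : ℝ) = q - 1 - i := by
      rw [Nat.cast_sub (by omega), Nat.cast_sub (by omega)]; simp
    push_cast
    rw [this]
    ring_nf
  have h4 := sum_range_inv_le_one_add_log T
  rw [h3]
  push_cast at *
  linarith

/-- The factor `1 / p` in the recursion cancels the `p` free values of the leading frequency, so
digits contribute additively. -/
theorem sum_digitWeight_le (p T : ℕ) [NeZero p] (r : ℕ) :
    ∑ h, digitWeight p T r h ≤ r * (3 + 2 * Real.log p) + (3 + 2 * Real.log T) := by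
  induction r with
  | zero =>
    rw [← (Equiv.funUnique (Fin 1) (ZMod p)).symm.sum_comp]
    simpa [digitWeight] using sum_intervalWeight_le p T
  | succ r ih =>
    rw [← (Fin.consEquiv fun _ : Fin (r + 1 + 1) => ZMod p).sum_comp, Fintype.sum_prod_type]
    simp only [digitWeight, Fin.consEquiv, Equiv.coe_fn_mk, Fin.tail_cons, Fin.cons_zero,
      Finset.sum_add_distrib, Finset.sum_ite_eq', Finset.mem_univ, if_true, ← Finset.mul_sum,
      Finset.sum_const, Finset.card_univ, ZMod.card, nsmul_eq_mul]
    have hp : (p : ℝ) ≠ 0 := by exact_mod_cast NeZero.ne p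
    have := sum_intervalWeight_le p p
    rw [← mul_assoc, one_div_mul_cancel hp, one_mul]
    push_cast
    linarith

/-! ### Geometric sums and smoothed intervals in `ℤ/p` -/

theorem four_mul_min_le_norm_stdAddChar_sub_one (p : ℕ) [NeZero p] (h : ZMod p) :
    4 * min (h.val : ℝ) (p - h.val) / p ≤ ‖ZMod.stdAddChar h - 1‖ := by
  have hp : (0 : ℝ) < p := by exact_mod_cast Nat.pos_of_ne_zero (NeZero.ne p)
  have hlt : (h.val : ℝ) < p := by exact_mod_cast ZMod.val_lt h
  have e1 : ZMod.stdAddChar h = Complex.exp (Complex.I * ((2 * Real.pi * h.val / p : ℝ) : ℂ)) := by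
    have := ZMod.stdAddChar_coe (N := p) (h.val : ℤ)
    rw [Int.cast_natCast, ZMod.natCast_zmod_val, Int.cast_natCast] at this
    rw [this]
    congr 1
    push_cast
    ring
  rw [e1, Complex.norm_exp_I_mul_ofReal_sub_one, Real.norm_eq_abs, abs_mul, abs_two]
  have hx : 2 * Real.pi * h.val / p / 2 = Real.pi * (h.val / p) := by ring
  rw [hx]
  set t : ℝ := h.val / p with ht
  have ht0 : 0 ≤ t := by positivity
  have ht1 : t ≤ 1 := by rw [ht, div_le_one hp]; exact hlt.le
  have hmin : 4 * min (h.val : ℝ) (p - h.val) / p = 4 * min t (1 - t) := by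
    rw [mul_div_assoc, ← min_div_div_right hp.le, sub_div, div_self hp.ne']
  rw [hmin]
  have hpi := Real.pi_pos
  rcases le_total t (1 / 2) with h2 | h2
  · have := Real.mul_le_sin (x := Real.pi * t) (by positivity) (by nlinarith)
    have e : 2 / Real.pi * (Real.pi * t) = 2 * t := by field_simp
    have := le_abs_self (Real.sin (Real.pi * t))
    have := min_le_left t (1 - t)
    linarith
  · have := Real.mul_le_sin (x := Real.pi * (1 - t)) (by nlinarith) (by nlinarith)
    have e : 2 / Real.pi * (Real.pi * (1 - t)) = 2 * (1 - t) := by field_simp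
    have e' : Real.sin (Real.pi * (1 - t)) = Real.sin (Real.pi * t) := by
      rw [mul_sub, mul_one, Real.sin_pi_sub]
    have := le_abs_self (Real.sin (Real.pi * t))
    have := min_le_right t (1 - t)
    linarith

theorem norm_sum_stdAddChar_pow_le (p : ℕ) [NeZero p] {h : ZMod p} (hh : h ≠ 0) (b : ℕ) :
    ‖∑ i ∈ range b, (ZMod.stdAddChar (-h) : ℂ) ^ i‖ ≤ p / (2 * min (h.val : ℝ) (p - h.val)) := by
  have hp : (0 : ℝ) < p := by exact_mod_cast Nat.pos_of_ne_zero (NeZero.ne p)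
  have hlt : (h.val : ℝ) < p := by exact_mod_cast ZMod.val_lt h
  have hpos : (0 : ℝ) < h.val := by
    have : h.val ≠ 0 := by simpa using hh
    exact_mod_cast Nat.pos_of_ne_zero this
  set μ := min (h.val : ℝ) (p - h.val) with hμ
  have hμ0 : 0 < μ := lt_min hpos (by linarith)
  have h1 := four_mul_min_le_norm_stdAddChar_sub_one p h
  rw [← hμ] at h1
  have h2 : ‖(ZMod.stdAddChar (-h) : ℂ) - 1‖ = ‖ZMod.stdAddChar h - 1‖ := by
    have : (ZMod.stdAddChar (-h) : ℂ) - 1 = -(ZMod.stdAddChar (-h)) * (ZMod.stdAddChar h - 1) := by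
      rw [neg_mul, mul_sub, ← AddChar.map_add_eq_mul]
      simp
    rw [this, norm_mul, norm_neg, AddChar.norm_apply, one_mul]
  have h3 : 0 < 4 * μ / p := by positivity
  have hne : (ZMod.stdAddChar (-h) : ℂ) ≠ 1 := by
    intro h0
    rw [h0] at h2
    simp at h2
    rw [← h2] at h1
    linarith
  rw [geom_sum_eq hne, norm_div, h2]
  have h4 : ‖(ZMod.stdAddChar (-h) : ℂ) ^ b - 1‖ ≤ 2 := by
    refine (norm_sub_le _ _).trans ?_
    rw [norm_pow, AddChar.norm_apply]
    norm_num
  calc _ ≤ 2 / (4 * μ / p) := by gcongr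
    _ = _ := by field_simp; norm_num

/-- The convolution of the indicator function of the residues `c, …, c + b - 1` with the uniform
probability on the residues `0, …, J - 1`. -/
noncomputable def smoothIndicator (p c b J : ℕ) (x : ZMod p) : ℝ :=
  (1 / J : ℝ) * ∑ j ∈ range J, ∑ i ∈ range b, if x = ((c + i + j : ℕ) : ZMod p) then 1 else 0

theorem ite_eq_sum_stdAddChar (p : ℕ) [NeZero p] (x y : ZMod p) :
    (if x = y then (1 : ℂ) else 0) =
      ∑ h : ZMod p, (1 / p : ℂ) * ZMod.stdAddChar (-h * y) * ZMod.stdAddChar (h * x) := by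
  have hp : (p : ℂ) ≠ 0 := by exact_mod_cast NeZero.ne p
  have h1 := AddChar.sum_mulShift (x - y) (ZMod.isPrimitive_stdAddChar p)
  have h2 : ∀ h : ZMod p, (1 / p : ℂ) * ZMod.stdAddChar (-h * y) * ZMod.stdAddChar (h * x) =
      (1 / p : ℂ) * ZMod.stdAddChar (h * (x - y)) := by
    intro h
    rw [mul_assoc, ← AddChar.map_add_eq_mul]
    congr 2
    ring
  simp_rw [h2, ← Finset.mul_sum, h1, sub_eq_zero, ZMod.card]
  split_ifs <;> simp [hp]

theorem hasDominatedExpansion_smoothIndicator (p c b J T : ℕ) [NeZero p] (hb : b ≤ p)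
    (hJ : 1 ≤ J) (hT : p ≤ T * J) :
    HasDominatedExpansion (fun h v : ZMod p => ZMod.stdAddChar (h * v)) (intervalWeight p T)
      (smoothIndicator p c b J) (b / p) := by
  have hp : (0 : ℝ) < p := by exact_mod_cast Nat.pos_of_ne_zero (NeZero.ne p)
  have hpc : (p : ℂ) ≠ 0 := by exact_mod_cast NeZero.ne p
  have hJ0 : (0 : ℝ) < J := by exact_mod_cast hJ
  have hJc : (J : ℂ) ≠ 0 := by exact_mod_cast hJ0.ne'
  have hT' : (p : ℝ) ≤ T * J := by exact_mod_cast hT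
  refine ⟨fun h => (1 / p : ℂ) * (1 / J : ℂ) * ZMod.stdAddChar (-h * (c : ZMod p)) *
    (∑ j ∈ range J, (ZMod.stdAddChar (-h) : ℂ) ^ j) *
    (∑ i ∈ range b, (ZMod.stdAddChar (-h) : ℂ) ^ i), ?_, fun h => ?_, fun v => ?_⟩
  · simp
    field_simp
  · rw [norm_mul, norm_mul, norm_mul, norm_mul, AddChar.norm_apply, mul_one, norm_div, norm_div,
      norm_one, Complex.norm_natCast, Complex.norm_natCast]
    have triv : ∀ n : ℕ, ‖∑ j ∈ range n, (ZMod.stdAddChar (-h) : ℂ) ^ j‖ ≤ n := by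
      intro n
      refine (norm_sum_le _ _).trans ?_
      simp [norm_pow]
    unfold intervalWeight
    split_ifs with hh
    · calc _ ≤ 1 / (p : ℝ) * (1 / J) * J * b := by
            gcongr
            · exact triv J
            · exact triv b
        _ = b / p := by field_simp
        _ ≤ 1 := by rw [div_le_one hp]; exact_mod_cast hb
    · have hlt : (h.val : ℝ) < p := by exact_mod_cast ZMod.val_lt h
      have hpos : (0 : ℝ) < h.val := by
        have : h.val ≠ 0 := by simpa using hh
        exact_mod_cast Nat.pos_of_ne_zero this
      have hT0 : (0 : ℝ) < T := by
        by_contra hn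
        nlinarith
      have hb1 := norm_sum_stdAddChar_pow_le p hh b
      have hJ1 := norm_sum_stdAddChar_pow_le p hh J
      have hJ2 := triv J
      set μ := min (h.val : ℝ) (p - h.val) with hμ
      have hμ0 : 0 < μ := lt_min hpos (by linarith)
      set B := ‖∑ i ∈ range b, (ZMod.stdAddChar (-h) : ℂ) ^ i‖
      set S := ‖∑ i ∈ range J, (ZMod.stdAddChar (-h) : ℂ) ^ i‖
      -- The normalised sum is at most `1` and, as `p ≤ T * J`, at most `T / (2 μ)`. Adding the two
      -- bounds after multiplying by `T` and by `μ` gives one expression valid in both ranges.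
      have hS : 1 / (J : ℝ) * S ≤ 2 * T / (μ + T) := by
        rw [le_div_iff₀ (by positivity)]
        have a1 : 1 / (J : ℝ) * S ≤ 1 := by
          rw [one_div, inv_mul_le_iff₀ hJ0]; linarith
        have a2 : 1 / (J : ℝ) * S * μ ≤ T := by
          calc 1 / (J : ℝ) * S * μ ≤ 1 / (J : ℝ) * (p / (2 * μ)) * μ := by gcongr
            _ = p / J / 2 := by field_simp
            _ ≤ T / 2 := by
              gcongr
              rwa [div_le_iff₀ hJ0]
            _ ≤ T := by linarith
        nlinarith
      have main : 1 / (p : ℝ) * (1 / J) * S * B ≤ 1 / μ - 1 / (μ + T) := by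
        calc 1 / (p : ℝ) * (1 / J) * S * B = 1 / (p : ℝ) * (1 / J * S) * B := by ring
          _ ≤ 1 / (p : ℝ) * (2 * T / (μ + T)) * (p / (2 * μ)) := by
            gcongr
          _ = 1 / μ - 1 / (μ + T) := by
            field_simp; ring
      refine main.trans ?_
      have n1 : 0 ≤ 1 / (h.val : ℝ) - 1 / ((h.val : ℝ) + T) :=
        sub_nonneg.2 (one_div_le_one_div_of_le hpos (by linarith))
      have n2 : 0 ≤ 1 / ((p : ℝ) - h.val) - 1 / ((p : ℝ) - h.val + T) :=
        sub_nonneg.2 (one_div_le_one_div_of_le (by linarith) (by linarith))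
      rcases min_choice (h.val : ℝ) (p - h.val) with hm | hm
      · rw [hμ, hm]; linarith
      · rw [hμ, hm]; linarith
  · unfold smoothIndicator
    have e1 : ∀ i j : ℕ, (((if v = ((c + i + j : ℕ) : ZMod p) then (1 : ℝ) else 0 : ℝ)) : ℂ) =
        ∑ h : ZMod p, (1 / p : ℂ) * ZMod.stdAddChar (-h * ((c + i + j : ℕ) : ZMod p)) *
          ZMod.stdAddChar (h * v) := by
      intro i j
      rw [← ite_eq_sum_stdAddChar]
      split_ifs <;> simp
    have e2 : ∀ (h : ZMod p) (i j : ℕ), (ZMod.stdAddChar (-h * ((c + i + j : ℕ) : ZMod p)) : ℂ) =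
        ZMod.stdAddChar (-h * (c : ZMod p)) * (ZMod.stdAddChar (-h)) ^ j *
          (ZMod.stdAddChar (-h)) ^ i := by
      intro h i j
      rw [← AddChar.map_nsmul_eq_pow, ← AddChar.map_nsmul_eq_pow, ← AddChar.map_add_eq_mul,
        ← AddChar.map_add_eq_mul]
      congr 1
      push_cast
      simp only [nsmul_eq_mul]
      ring
    rw [Complex.ofReal_mul, Complex.ofReal_sum]
    simp_rw [Complex.ofReal_sum, e1, e2]
    rw [Finset.sum_congr rfl fun j _ => Finset.sum_comm, Finset.sum_comm, Finset.mul_sum]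
    refine Finset.sum_congr rfl fun h _ => ?_
    simp_rw [mul_assoc (1 / (p : ℂ) * (1 / J) * _), Finset.sum_mul_sum]
    simp only [Finset.mul_sum, Finset.sum_mul]
    refine Finset.sum_congr rfl fun j _ => Finset.sum_congr rfl fun i _ => ?_
    push_cast
    ring

theorem smoothIndicator_nonneg (p c b J : ℕ) (x : ZMod p) : 0 ≤ smoothIndicator p c b J x := by
  unfold smoothIndicator
  positivity

/-- With `l + 1 - J` starting residues and shifts up to `J - 1`, the support stays inside an
interval of length `l`, and each shift hits a given residue at most once. If `J > l` the truncated
subtraction makes the function zero. -/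
theorem smoothIndicator_le (p c l J : ℕ) [NeZero p] (hl : c + l ≤ p) (hJ : 1 ≤ J) (x : ZMod p) :
    smoothIndicator p c (l + 1 - J) J x ≤ if c ≤ x.val ∧ x.val < c + l then 1 else 0 := by
  have hJ0 : (0 : ℝ) < J := by exact_mod_cast hJ
  have key : ∀ j < J, ∀ i < l + 1 - J, x = ((c + i + j : ℕ) : ZMod p) ↔ c + i + j = x.val := by
    intro j hj i hi
    constructor
    · rintro rfl
      rw [ZMod.val_natCast_of_lt (by omega)]
    · intro h
      rw [h]
      simp
  unfold smoothIndicator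
  split_ifs with hx
  · rw [one_div, inv_mul_le_iff₀ hJ0, mul_one]
    calc _ ≤ ∑ j ∈ range J, (1 : ℝ) := Finset.sum_le_sum fun j hj => ?_
      _ = J := by simp
    rw [Finset.sum_ite, Finset.sum_const_zero, add_zero, Finset.sum_const, nsmul_eq_mul, mul_one]
    have : (#{i ∈ range (l + 1 - J) | x = ((c + i + j : ℕ) : ZMod p)}) ≤ 1 := by
      rw [Finset.card_le_one]
      intro a ha b hb
      simp only [Finset.mem_filter, Finset.mem_range] at ha hb hj
      have := (key j hj a ha.1).1 ha.2
      have := (key j hj b hb.1).1 hb.2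
      omega
    exact_mod_cast this
  · refine le_of_eq ?_
    rw [Finset.sum_eq_zero, mul_zero]
    intro j hj
    refine Finset.sum_eq_zero fun i hi => if_neg fun h => hx ?_
    simp only [Finset.mem_range] at hi hj
    have := (key j hj i hi).1 h
    omega

theorem smoothIndicator_one (p c l : ℕ) [NeZero p] (hl : c + l ≤ p) (x : ZMod p) :
    smoothIndicator p c l 1 x = if c ≤ x.val ∧ x.val < c + l then 1 else 0 := by
  refine le_antisymm (smoothIndicator_le p c l 1 hl le_rfl x) ?_
  split_ifs with hx
  · unfold smoothIndicator
    simp only [Nat.cast_one, div_one, one_mul, range_one, sum_singleton, add_zero]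
    refine le_trans ?_ (Finset.single_le_sum (fun i _ => by positivity)
      (Finset.mem_range.2 (by omega : x.val - c < l)))
    rw [if_pos]
    rw [show c + (x.val - c) = x.val by omega]
    simp
  · exact smoothIndicator_nonneg _ _ _ _ _

/-! ### Lexicographic order on digit blocks -/

/-- The integer with base `p` digits `v 0, …, v (r - 1)`, the most significant one first. -/
def digitVal {p r : ℕ} (v : Fin r → ZMod p) : ℕ :=
  ∑ j, (v j).val * p ^ (r - 1 - (j : ℕ))

theorem digitVal_one {p : ℕ} (v : Fin 1 → ZMod p) : digitVal v = (v 0).val := by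
  simp [digitVal]

theorem digitVal_succ {p r : ℕ} (v : Fin (r + 1) → ZMod p) :
    digitVal v = (v 0).val * p ^ r + digitVal (Fin.tail v) := by
  unfold digitVal
  rw [Fin.sum_univ_succ]
  congr 1
  refine Finset.sum_congr rfl fun j _ => ?_
  simp only [Fin.tail, Fin.val_succ]
  congr 2
  omega

theorem digitVal_lt {p : ℕ} [NeZero p] : ∀ {r : ℕ} (v : Fin r → ZMod p), digitVal v < p ^ r
  | 0, v => by simp [digitVal]
  | r + 1, v => by
    rw [digitVal_succ]
    have h1 := digitVal_lt (Fin.tail v)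
    have h2 : (v 0).val + 1 ≤ p := ZMod.val_lt (v 0)
    calc _ < (v 0).val * p ^ r + p ^ r := by omega
      _ = ((v 0).val + 1) * p ^ r := by ring
      _ ≤ p * p ^ r := by gcongr
      _ = _ := by ring

theorem digitVal_lt_iff {p r a₀ a₁ : ℕ} [NeZero p] (h₁ : a₁ < p ^ r) (v : Fin (r + 1) → ZMod p) :
    digitVal v < a₀ * p ^ r + a₁ ↔
      (v 0).val < a₀ ∨ (v 0).val = a₀ ∧ digitVal (Fin.tail v) < a₁ := by
  rw [digitVal_succ]
  have h2 := digitVal_lt (Fin.tail v)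
  rcases lt_trichotomy (v 0).val a₀ with h | h | h
  · have : ((v 0).val + 1) * p ^ r ≤ a₀ * p ^ r := by gcongr; exact h
    constructor
    · intro _; exact Or.inl h
    · intro _; linarith
  · simp [h]
  · have : (a₀ + 1) * p ^ r ≤ (v 0).val * p ^ r := by gcongr; exact h
    constructor
    · intro _; linarith
    · rintro (h' | h') <;> omega

theorem digitChar_succ (p : ℕ) [NeZero p] {r : ℕ} (h v : Fin (r + 1) → ZMod p) :
    digitChar p h v = ZMod.stdAddChar (h 0 * v 0) * digitChar p (Fin.tail h) (Fin.tail v) := by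
  unfold digitChar
  rw [Fin.prod_univ_succ]
  rfl

/-- Being below a bound means that the leading digit is smaller, or that it agrees and the tail is
below the remaining bound. This transfers an approximation for the tail to one more digit, dividing
its error by `p`. -/
theorem hasDominatedExpansion_lex {p T r a₀ : ℕ} [NeZero p] (h₀ : a₀ < p)
    {f : (Fin (r + 1) → ZMod p) → ℝ} {m : ℝ}
    (hf : HasDominatedExpansion (digitChar p) (digitWeight p T r) f m) :
    HasDominatedExpansion (digitChar p) (digitWeight p T (r + 1))
      (fun v => (if (v 0).val < a₀ then 1 else 0) +
        (if (v 0).val = a₀ then 1 else 0) * f (Fin.tail v)) ((a₀ + m) / p) := by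
  have hp : (p : ℂ) ≠ 0 := by exact_mod_cast NeZero.ne p
  obtain ⟨b, hb0, hbρ, hbf⟩ :=
    hasDominatedExpansion_smoothIndicator p 0 a₀ 1 p h₀.le le_rfl (by simp)
  obtain ⟨c, hc0, hcρ, hcf⟩ := hf
  have htail : Fin.tail (0 : Fin (r + 1 + 1) → ZMod p) = 0 := rfl
  refine ⟨fun h => (if Fin.tail h = 0 then b (h 0) else 0) +
    (1 / p : ℂ) * ZMod.stdAddChar (-(h 0) * (a₀ : ZMod p)) * c (Fin.tail h), ?_, fun h => ?_,
    fun v => ?_⟩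
  · simp [htail, hb0, hc0]
    ring
  · refine (norm_add_le _ _).trans ?_
    rw [norm_mul, norm_mul, AddChar.norm_apply, mul_one, norm_div, norm_one,
      Complex.norm_natCast]
    unfold digitWeight
    gcongr
    · split_ifs
      · exact hbρ _
      · simp
    · exact hcρ _
  · have e1 := hbf (v 0)
    rw [smoothIndicator_one p 0 a₀ (by omega)] at e1
    simp only [zero_le, zero_add, true_and] at e1
    have e2 : (((if (v 0).val = a₀ then (1 : ℝ) else 0 : ℝ)) : ℂ) =
        ∑ h : ZMod p, (1 / p : ℂ) * ZMod.stdAddChar (-h * (a₀ : ZMod p)) *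
          ZMod.stdAddChar (h * v 0) := by
      rw [← ite_eq_sum_stdAddChar]
      have : (v 0).val = a₀ ↔ v 0 = (a₀ : ZMod p) := by
        constructor
        · intro h; rw [← h]; simp
        · intro h; rw [h, ZMod.val_natCast_of_lt h₀]
      simp only [this]
      split_ifs <;> simp
    rw [Complex.ofReal_add, Complex.ofReal_mul, e1, e2, hcf,
      ← (Fin.consEquiv fun _ : Fin (r + 1 + 1) => ZMod p).sum_comp, Fintype.sum_prod_type]
    simp only [Fin.consEquiv, Equiv.coe_fn_mk, @digitChar_succ p _ (r + 1), Fin.tail_cons, Fin.cons_zero,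
      add_mul, Finset.sum_add_distrib]
    congr 1
    · refine Finset.sum_congr rfl fun h _ => ?_
      rw [Finset.sum_eq_single 0]
      · simp [digitChar_zero]
      · intro h' _ hh'; simp [hh']
      · simp
    · rw [Finset.sum_mul_sum]
      refine Finset.sum_congr rfl fun h _ => Finset.sum_congr rfl fun h' _ => ?_
      ring

theorem HasDominatedExpansion.comp_head {p T : ℕ} [NeZero p] {f : ZMod p → ℝ} {m : ℝ}
    (hf : HasDominatedExpansion (fun h v : ZMod p => ZMod.stdAddChar (h * v))
      (intervalWeight p T) f m) :
    HasDominatedExpansion (digitChar p) (digitWeight p T 0) (fun v => f (v 0)) m := by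
  obtain ⟨c, hc0, hcρ, hcf⟩ := hf
  refine ⟨fun h => c (h 0), by simpa using hc0, fun h => hcρ _, fun v => ?_⟩
  rw [← (Equiv.funUnique (Fin 1) (ZMod p)).symm.sum_comp, hcf]
  simp [digitChar]

theorem hasDominatedExpansion_one (p T r : ℕ) [NeZero p] :
    HasDominatedExpansion (digitChar p) (digitWeight p T r) (fun _ => 1) 1 :=
  HasDominatedExpansion.one (digitChar_zero p _) (digitWeight_nonneg p T r)
    (one_le_digitWeight_zero p T r)

/-! ### Minorants and majorants of initial intervals -/

/-- Only the least significant digit is smoothed; the digits above it are treated exactly. The error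
`J` is thus measured in units of the finest resolution. -/
theorem exists_digit_minorant {p T J : ℕ} [NeZero p] (hJ : 1 ≤ J) (hT : p ≤ T * J) (r : ℕ)
    {a : ℕ} (ha : a ≤ p ^ (r + 1)) :
    ∃ f m, HasDominatedExpansion (digitChar p) (digitWeight p T r) f m ∧
      (∀ v, 0 ≤ f v ∧ f v ≤ if digitVal v < a then 1 else 0) ∧
      ((a : ℝ) - J) / (p : ℝ) ^ (r + 1) ≤ m ∧ m ≤ (a : ℝ) / (p : ℝ) ^ (r + 1) ∧ 0 ≤ m := by
  have hp : (0 : ℝ) < p := by exact_mod_cast Nat.pos_of_ne_zero (NeZero.ne p)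
  have hJ' : (1 : ℝ) ≤ J := by exact_mod_cast hJ
  induction r generalizing a with
  | zero =>
    have ha' : 0 + a ≤ p := by simpa using ha
    refine ⟨_, _, (hasDominatedExpansion_smoothIndicator p 0 (a + 1 - J) J T (by omega) hJ
      hT).comp_head, fun v => ⟨smoothIndicator_nonneg _ _ _ _ _, ?_⟩, ?_, ?_, ?_⟩
    · rw [digitVal_one]
      simpa using smoothIndicator_le p 0 a J ha' hJ (v 0)
    · rw [zero_add, pow_one]
      gcongr
      have : a + 1 ≤ (a + 1 - J) + J := by omega
      have : (a : ℝ) + 1 ≤ (a + 1 - J : ℕ) + J := by exact_mod_cast this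
      linarith
    · rw [zero_add, pow_one]
      gcongr
      omega
    · positivity
  | succ r ih =>
    -- For `a = p ^ (r + 2)` the leading digit of `a` would be `p`, so the constant function `1`
    -- replaces the recursion.
    rcases ha.lt_or_eq with hlt | rfl
    · have hpp : 0 < p ^ (r + 1) := pow_pos (Nat.pos_of_ne_zero (NeZero.ne p)) _
      have hmod := Nat.mod_lt a hpp
      have hdiv : a / p ^ (r + 1) < p := by
        rw [Nat.div_lt_iff_lt_mul hpp]
        rwa [pow_succ' p (r + 1)] at hlt
      obtain ⟨f, m, hf, hfv, hm1, hm2, hm0⟩ := ih hmod.le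
      have hsplit : a / p ^ (r + 1) * p ^ (r + 1) + a % p ^ (r + 1) = a := Nat.div_add_mod' _ _
      have hiff := fun v => digitVal_lt_iff (p := p) (a₀ := a / p ^ (r + 1)) hmod v
      rw [hsplit] at hiff
      have hreal : (a : ℝ) = (a / p ^ (r + 1) : ℕ) * (p : ℝ) ^ (r + 1) + (a % p ^ (r + 1) : ℕ) := by
        exact_mod_cast hsplit.symm
      set a₀ := a / p ^ (r + 1)
      set a₁ := a % p ^ (r + 1)
      refine ⟨_, _, hasDominatedExpansion_lex hdiv hf, fun v => ?_, ?_, ?_, ?_⟩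
      · obtain ⟨n1, n2⟩ := hfv (Fin.tail v)
        simp only [hiff]
        rcases lt_trichotomy (v 0).val a₀ with h | h | h
        · simp [h, h.ne]
        · simp [h, n1, n2]
        · simp [h.not_gt, h.ne']
      · rw [hreal, pow_succ _ (r + 1), ← div_div]
        gcongr
        rw [add_sub_assoc, add_div, mul_div_cancel_right₀ _ (by positivity)]
        linarith
      · rw [hreal, pow_succ _ (r + 1), ← div_div]
        gcongr
        rw [add_div, mul_div_cancel_right₀ _ (by positivity)]
        linarith
      · positivity
    · refine ⟨_, _, hasDominatedExpansion_one p T (r + 1), fun v => ⟨zero_le_one, ?_⟩, ?_, ?_, zero_le_one⟩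
      · rw [if_pos (digitVal_lt v)]
      · rw [div_le_one (by positivity)]
        push_cast
        linarith
      · push_cast
        rw [div_self (by positivity)]

theorem exists_digit_majorant {p T J : ℕ} [NeZero p] (hJ : 1 ≤ J) (hT : p ≤ T * J) (r : ℕ)
    {a : ℕ} (ha : a ≤ p ^ (r + 1)) :
    ∃ f m, HasDominatedExpansion (digitChar p) (digitWeight p T r) f m ∧
      (∀ v, (if digitVal v < a then 1 else 0) ≤ f v ∧ f v ≤ 1) ∧
      (a : ℝ) / (p : ℝ) ^ (r + 1) ≤ m ∧ m ≤ ((a : ℝ) + J) / (p : ℝ) ^ (r + 1) ∧ m ≤ 1 := by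
  have hp : (0 : ℝ) < p := by exact_mod_cast Nat.pos_of_ne_zero (NeZero.ne p)
  have hJ' : (1 : ℝ) ≤ J := by exact_mod_cast hJ
  induction r generalizing a with
  | zero =>
    have ha' : a ≤ p := by simpa using ha
    have hb : p - a + 1 - J ≤ p := by omega
    have hb' : (0 : ℝ) ≤ ((p - a + 1 - J : ℕ) : ℝ) / p := by positivity
    -- The majorant of `[0, a)` is one minus the minorant of the complement `[a, p)`.
    refine ⟨_, _, ((hasDominatedExpansion_smoothIndicator p a (p - a + 1 - J) J T hb hJ
      hT).one_sub (by funext v; simp) (by simp [intervalWeight]) hb' ?_).comp_head,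
      fun v => ⟨?_, ?_⟩, ?_, ?_, ?_⟩
    · rw [div_le_one hp]; exact_mod_cast hb
    · rw [digitVal_one]
      have h1 := smoothIndicator_le p a (p - a) J (by omega) hJ (v 0)
      have h2 := ZMod.val_lt (v 0)
      split_ifs at h1 ⊢ with h3 h4
      · omega
      · linarith
      · linarith
      · omega
    · have := smoothIndicator_nonneg p a (p - a + 1 - J) J (v 0)
      linarith
    · rw [zero_add, pow_one, div_le_iff₀ hp, sub_mul, div_mul_cancel₀ _ hp.ne']
      have : (p - a + 1 - J) + a ≤ p := by omega
      have : ((p - a + 1 - J : ℕ) : ℝ) + a ≤ p := by exact_mod_cast this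
      linarith
    · rw [zero_add, pow_one, le_div_iff₀ hp, sub_mul, div_mul_cancel₀ _ hp.ne']
      have : p + 1 ≤ (p - a + 1 - J) + a + J := by omega
      have : (p : ℝ) + 1 ≤ ((p - a + 1 - J : ℕ) : ℝ) + a + J := by exact_mod_cast this
      linarith
    · linarith
  | succ r ih =>
    rcases ha.lt_or_eq with hlt | rfl
    · have hpp : 0 < p ^ (r + 1) := pow_pos (Nat.pos_of_ne_zero (NeZero.ne p)) _
      have hmod := Nat.mod_lt a hpp
      have hdiv : a / p ^ (r + 1) < p := by
        rw [Nat.div_lt_iff_lt_mul hpp]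
        rwa [pow_succ' p (r + 1)] at hlt
      obtain ⟨f, m, hf, hfv, hm1, hm2, hm3⟩ := ih hmod.le
      have hsplit : a / p ^ (r + 1) * p ^ (r + 1) + a % p ^ (r + 1) = a := Nat.div_add_mod' _ _
      have hiff := fun v => digitVal_lt_iff (p := p) (a₀ := a / p ^ (r + 1)) hmod v
      rw [hsplit] at hiff
      have hreal : (a : ℝ) = (a / p ^ (r + 1) : ℕ) * (p : ℝ) ^ (r + 1) + (a % p ^ (r + 1) : ℕ) := by
        exact_mod_cast hsplit.symm
      set a₀ := a / p ^ (r + 1)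
      set a₁ := a % p ^ (r + 1)
      refine ⟨_, _, hasDominatedExpansion_lex hdiv hf, fun v => ?_, ?_, ?_, ?_⟩
      · obtain ⟨n1, n2⟩ := hfv (Fin.tail v)
        simp only [hiff]
        rcases lt_trichotomy (v 0).val a₀ with h | h | h
        · simp [h, h.ne]
        · simp [h, n1, n2]
        · simp [h.not_gt, h.ne']
      · rw [hreal, pow_succ _ (r + 1), ← div_div]
        gcongr
        rw [add_div, mul_div_cancel_right₀ _ (by positivity)]
        linarith
      · rw [hreal, pow_succ _ (r + 1), ← div_div]
        gcongr
        rw [add_assoc, add_div, mul_div_cancel_right₀ _ (by positivity)]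
        linarith
      · rw [div_le_one hp]
        have : (a₀ : ℝ) + 1 ≤ p := by exact_mod_cast hdiv
        linarith
    · refine ⟨_, _, hasDominatedExpansion_one p T (r + 1), fun v => ⟨?_, le_rfl⟩, ?_, ?_, le_rfl⟩
      · rw [if_pos (digitVal_lt v)]
      · push_cast
        rw [div_self (by positivity)]
      · rw [le_div_iff₀ (by positivity)]
        push_cast
        linarith

/-! ### The Erdős–Turán–Koksma inequality -/

theorem abs_prod_sub_prod_le {ι : Type*} (t : Finset ι) {a b : ι → ℝ} {δ : ℝ}
    (ha : ∀ i, 0 ≤ a i ∧ a i ≤ 1) (hb : ∀ i, 0 ≤ b i ∧ b i ≤ 1) (h : ∀ i, |a i - b i| ≤ δ) :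
    |∏ i ∈ t, a i - ∏ i ∈ t, b i| ≤ #t * δ := by
  classical
  induction t using Finset.induction_on with
  | empty => simp
  | insert i t hi ih =>
    rw [Finset.prod_insert hi, Finset.prod_insert hi, Finset.card_insert_of_notMem hi]
    have e : a i * ∏ j ∈ t, a j - b i * ∏ j ∈ t, b j =
        a i * (∏ j ∈ t, a j - ∏ j ∈ t, b j) + (a i - b i) * ∏ j ∈ t, b j := by ring
    have h1 : |∏ j ∈ t, b j| ≤ 1 := by
      rw [abs_of_nonneg (Finset.prod_nonneg fun j _ => (hb j).1)]
      exact Finset.prod_le_one (fun j _ => (hb j).1) fun j _ => (hb j).2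
    have h2 : |a i| ≤ 1 := by rw [abs_of_nonneg (ha i).1]; exact (ha i).2
    rw [e]
    refine (abs_add_le _ _).trans ?_
    rw [abs_mul, abs_mul]
    have h3 := mul_le_mul h2 ih (abs_nonneg _) zero_le_one
    have h4 := mul_le_mul (h i) h1 (abs_nonneg _) ((abs_nonneg _).trans (h i))
    push_cast
    linarith

/-- The character of `((ℤ/p)^r)^s` with frequency `h`. -/
noncomputable def boxChar (p : ℕ) [NeZero p] {s r : ℕ} (h v : Fin s → Fin r → ZMod p) : ℂ :=
  ∏ i, digitChar p (h i) (v i)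

/-- The product over the `s` coordinates of `digitWeight`. -/
noncomputable def boxWeight (p T r : ℕ) {s : ℕ} (h : Fin s → Fin (r + 1) → ZMod p) : ℝ :=
  ∏ i, digitWeight p T r (h i)

theorem boxChar_zero (p : ℕ) [NeZero p] (s r : ℕ) :
    boxChar p (0 : Fin s → Fin r → ZMod p) = 1 := by
  funext v
  simp [boxChar, digitChar_zero]

theorem boxWeight_nonneg (p T r : ℕ) [NeZero p] {s : ℕ} (h : Fin s → Fin (r + 1) → ZMod p) :
    0 ≤ boxWeight p T r h :=
  Finset.prod_nonneg fun _ _ => digitWeight_nonneg _ _ _ _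

theorem sum_boxWeight (p T r s : ℕ) [NeZero p] :
    ∑ h : Fin s → Fin (r + 1) → ZMod p, boxWeight p T r h = (∑ h, digitWeight p T r h) ^ s := by
  unfold boxWeight
  rw [← Fintype.prod_sum (fun (_ : Fin s) h => digitWeight p T r h)]
  simp

/-- A truncated digital form of the inequality of Erdős, Turán and Koksma. -/
theorem discrepancy_le {p T J r s : ℕ} [NeZero p] (hJ : 1 ≤ J) (hT : p ≤ T * J)
    (x : ℕ → Fin s → ℝ) (v : ℕ → Fin s → Fin (r + 1) → ZMod p)
    (hx : ∀ n i, (digitVal (v n i) : ℝ) ≤ x n i * (p : ℝ) ^ (r + 1) ∧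
      x n i * (p : ℝ) ^ (r + 1) < digitVal (v n i) + 1) {N : ℕ} (hN : 1 ≤ N) :
    discrepancy x N ≤ s * (2 * J / (p : ℝ) ^ (r + 1)) +
      (∑ h ∈ univ.erase 0, boxWeight p T r h * ‖∑ n ∈ range N, boxChar p h (v n)‖) / N := by
  have hp : (0 : ℝ) < p := by exact_mod_cast Nat.pos_of_ne_zero (NeZero.ne p)
  have hJ' : (1 : ℝ) ≤ J := by exact_mod_cast hJ
  have hN' : (0 : ℝ) < N := by exact_mod_cast hN
  unfold discrepancy
  refine csSup_le ⟨_, fun _ => 1, by simp, rfl⟩ ?_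
  rintro d ⟨γ, hγ, rfl⟩
  set P : ℝ := (p : ℝ) ^ (r + 1) with hP
  have hP0 : 0 < P := by positivity
  set E := ∑ h ∈ univ.erase 0, boxWeight p T r h * ‖∑ n ∈ range N, boxChar p h (v n)‖
  have hγP : ∀ i, 0 ≤ γ i * P := fun i => mul_nonneg (hγ i).1.le hP0.le
  have hγP1 : ∀ i, γ i * P ≤ (p ^ (r + 1) : ℕ) := fun i => by
    push_cast
    rw [← hP]
    nlinarith [(hγ i).2]
  have hfl : ∀ i, ⌊γ i * P⌋₊ ≤ p ^ (r + 1) := fun i => Nat.floor_le_of_le (hγP1 i)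
  have hce : ∀ i, ⌈γ i * P⌉₊ ≤ p ^ (r + 1) := fun i => Nat.ceil_le.2 (hγP1 i)
  choose f m hf hfv hm1 hm2 hm0 using fun i => exists_digit_minorant hJ hT r (hfl i)
  choose g l hg hgv hl1 hl2 hl3 using fun i => exists_digit_majorant hJ hT r (hce i)
  have hmγ : ∀ i, m i ≤ γ i := fun i =>
    (hm2 i).trans ((div_le_iff₀ hP0).2 (Nat.floor_le (hγP i)))
  have hlγ : ∀ i, γ i ≤ l i := fun i =>
    ((le_div_iff₀ hP0).2 (Nat.le_ceil _)).trans (hl1 i)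
  -- Rounding `γ i * P` to an integer costs less than `1` and smoothing costs `J`; as `1 ≤ J`, the
  -- total is at most `2 * J`.
  have hmd : ∀ i, |m i - γ i| ≤ 2 * J / P := fun i => by
    rw [abs_sub_comm, abs_of_nonneg (sub_nonneg.2 (hmγ i))]
    have h1 := hm1 i
    rw [div_le_iff₀ hP0] at h1
    rw [le_div_iff₀ hP0, sub_mul]
    have := Nat.lt_floor_add_one (γ i * P)
    linarith
  have hld : ∀ i, |l i - γ i| ≤ 2 * J / P := fun i => by
    rw [abs_of_nonneg (sub_nonneg.2 (hlγ i))]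
    have h1 := hl2 i
    rw [le_div_iff₀ hP0] at h1
    rw [le_div_iff₀ hP0, sub_mul]
    have := Nat.ceil_lt_add_one (hγP i)
    linarith
  have hγ' : ∀ i, 0 ≤ γ i ∧ γ i ≤ 1 := fun i => ⟨(hγ i).1.le, (hγ i).2⟩
  have dm := abs_prod_sub_prod_le univ (fun i => ⟨hm0 i, (hmγ i).trans (hγ i).2⟩) hγ' hmd
  have dl := abs_prod_sub_prod_le univ (fun i => ⟨(hγ' i).1.trans (hlγ i), hl3 i⟩) hγ' hld
  rw [Finset.card_univ, Fintype.card_fin] at dm dl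
  have em := (HasDominatedExpansion.pi hf).abs_sum_sub_le (boxChar_zero p s (r + 1)) v N
  have el := (HasDominatedExpansion.pi hg).abs_sum_sub_le (boxChar_zero p s (r + 1)) v N
  change _ ≤ E at em
  change _ ≤ E at el
  classical
  have hlow : ∑ n ∈ range N, ∏ i, f i (v n i) ≤
      (#{n ∈ range N | ∀ i, x n i ∈ Set.Ico 0 (γ i)} : ℝ) := by
    rw [Finset.natCast_card_filter]
    refine Finset.sum_le_sum fun n _ => ?_
    split_ifs with hn
    · refine Finset.prod_le_one (fun i _ => (hfv i _).1) fun i _ => (hfv i _).2.trans ?_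
      split_ifs <;> norm_num
    · refine le_of_eq ?_
      push Not at hn
      obtain ⟨i, hi⟩ := hn
      refine Finset.prod_eq_zero (Finset.mem_univ i) (le_antisymm ((hfv i _).2.trans ?_)
        (hfv i _).1)
      rw [if_neg]
      intro hlt
      obtain ⟨x1, x2⟩ := hx n i
      apply hi
      constructor
      · by_contra hneg
        push Not at hneg
        have : x n i * P < 0 := mul_neg_of_neg_of_pos hneg hP0
        have : (0 : ℝ) ≤ digitVal (v n i) := by positivity
        linarith
      · have h1 : (digitVal (v n i) : ℝ) + 1 ≤ ⌊γ i * P⌋₊ := by exact_mod_cast hlt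
        have h2 := Nat.floor_le (hγP i)
        exact lt_of_mul_lt_mul_right (by linarith : x n i * P < γ i * P) hP0.le
  have hupp : (#{n ∈ range N | ∀ i, x n i ∈ Set.Ico 0 (γ i)} : ℝ) ≤
      ∑ n ∈ range N, ∏ i, g i (v n i) := by
    have hg0 : ∀ i w, 0 ≤ g i w := fun i w => le_trans (by split_ifs <;> norm_num) (hgv i w).1
    rw [Finset.natCast_card_filter]
    refine Finset.sum_le_sum fun n _ => ?_
    split_ifs with hn
    · refine le_of_eq (Finset.prod_eq_one fun i _ => le_antisymm (hgv i _).2 ?_).symm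
      have h1 := (hgv i (v n i)).1
      rwa [if_pos] at h1
      obtain ⟨x1, x2⟩ := hx n i
      have h2 := (hn i).2
      have h3 := Nat.le_ceil (γ i * P)
      have h4 : x n i * P < γ i * P := mul_lt_mul_of_pos_right h2 hP0
      have h5 : (digitVal (v n i) : ℝ) < ⌈γ i * P⌉₊ := by linarith
      exact_mod_cast h5
    · exact Finset.prod_nonneg fun i _ => hg0 i _
  set C : ℝ := (#{n ∈ range N | ∀ i, x n i ∈ Set.Ico 0 (γ i)} : ℝ)
  have key : |C - N * ∏ i, γ i| ≤ N * (s * (2 * J / P)) + E := by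
    rw [abs_le] at dm dl em el ⊢
    have a1 := mul_le_mul_of_nonneg_left dm.1 hN'.le
    have a2 := mul_le_mul_of_nonneg_left dl.2 hN'.le
    constructor
    · linarith [em.1]
    · linarith [el.2]
  have : C / N - ∏ i, γ i = (C - N * ∏ i, γ i) / N := by field_simp
  rw [this, abs_div, abs_of_pos hN', div_le_iff₀ hN', add_mul, div_mul_cancel₀ _ hN'.ne']
  linarith

/-! ### Leading digits of the multistep numbers -/

/-- The leading `r` base `p` digits determine a multistep number up to an error `p⁻ʳ`. -/
theorem digitVal_le_multistep_mul {p k r : ℕ} [NeZero p] (hr : r ≤ k) (y : ℕ → ZMod p) (n : ℕ) :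
    (digitVal (fun j : Fin r => y (k * n + j)) : ℝ) ≤ multistep p k y n * (p : ℝ) ^ r ∧
      multistep p k y n * (p : ℝ) ^ r < digitVal (fun j : Fin r => y (k * n + j)) + 1 := by
  have hp0 : (0 : ℝ) < p := by exact_mod_cast Nat.pos_of_ne_zero (NeZero.ne p)
  have hm : multistep p k y n = ∑ j ∈ range k, ((y (k * n + j)).val : ℝ) / (p : ℝ) ^ (j + 1) := by
    unfold multistep
    rw [Finset.range_eq_Ico, ← Finset.Ico_add_one_right_eq_Icc]
    exact (Finset.sum_Ico_add' (fun j => ((y (k * n + j - 1)).val : ℝ) / (p : ℝ) ^ j) 0 k 1).symm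
  obtain ⟨t, rfl⟩ := Nat.exists_eq_add_of_le hr
  rw [hm, Finset.sum_range_add, add_mul (Finset.sum _ _)]
  have h1 : (∑ j ∈ range r, ((y ((r + t) * n + j)).val : ℝ) / (p : ℝ) ^ (j + 1)) * (p : ℝ) ^ r =
      digitVal (fun j : Fin r => y ((r + t) * n + j)) := by
    unfold digitVal
    push_cast
    rw [Fin.sum_univ_eq_sum_range (fun j => ((y ((r + t) * n + j)).val : ℝ) *
      (p : ℝ) ^ (r - 1 - j)), Finset.sum_mul]
    refine Finset.sum_congr rfl fun j hj => ?_
    have hj := Finset.mem_range.1 hj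
    have : (p : ℝ) ^ r = (p : ℝ) ^ (r - 1 - j) * (p : ℝ) ^ (j + 1) := by
      rw [← pow_add]; congr 1; omega
    rw [this]
    field_simp
  rw [h1]
  -- The deficit `1 / p ^ t` makes the upper bound strict: the discarded digits never add up to a
  -- full unit.
  have h2 : ∀ (z : ℕ → ZMod p) (t : ℕ),
      ∑ j ∈ range t, ((z j).val : ℝ) / (p : ℝ) ^ (j + 1) ≤ 1 - 1 / (p : ℝ) ^ t := by
    intro z t
    induction t with
    | zero => simp
    | succ t ih =>
      rw [Finset.sum_range_succ]
      have hz : ((z t).val : ℝ) + 1 ≤ p := by exact_mod_cast ZMod.val_lt (z t)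
      have : ((z t).val : ℝ) / (p : ℝ) ^ (t + 1) ≤ (p - 1) / (p : ℝ) ^ (t + 1) := by
        gcongr; linarith
      have e : ((p : ℝ) - 1) / (p : ℝ) ^ (t + 1) = 1 / (p : ℝ) ^ t - 1 / (p : ℝ) ^ (t + 1) := by
        rw [pow_succ]; field_simp
      linarith
  have h3 : (∑ j ∈ range t, ((y ((r + t) * n + (r + j))).val : ℝ) / (p : ℝ) ^ (r + j + 1)) *
      (p : ℝ) ^ r = ∑ j ∈ range t, ((y ((r + t) * n + (r + j))).val : ℝ) / (p : ℝ) ^ (j + 1) := by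
    rw [Finset.sum_mul]
    refine Finset.sum_congr rfl fun j _ => ?_
    rw [add_assoc r j 1, pow_add]
    field_simp
  rw [h3]
  have h4 := h2 (fun j => y ((r + t) * n + (r + j))) t
  have h5 : 0 < 1 / (p : ℝ) ^ t := by positivity
  have h6 : 0 ≤ ∑ j ∈ range t, ((y ((r + t) * n + (r + j))).val : ℝ) / (p : ℝ) ^ (j + 1) := by
    positivity
  constructor <;> linarith

/-! ### Maximal inequality over dyadic blocks -/

/-- The Rademacher–Menshov inequality: a maximal inequality through dyadic blocks. -/
theorem norm_sum_range_sq_le_dyadic (z : ℕ → ℂ) {M N : ℕ} (hN : N < 2 ^ M) :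
    ‖∑ n ∈ range N, z n‖ ^ 2 ≤ M * ∑ i ∈ range M, ∑ a ∈ range (2 ^ (M - i)),
      ‖∑ n ∈ Ico (a * 2 ^ i) (a * 2 ^ i + 2 ^ i), z n‖ ^ 2 := by
  -- `S i` stops at `N` rounded down to a multiple of `2 ^ i`. Hence `S i - S (i + 1)` is zero or a
  -- single block of length `2 ^ i`, according to the binary digit of `N` at `i`. Cauchy–Schwarz
  -- over the scales then costs the factor `M`.
  set S : ℕ → ℂ := fun i => ∑ n ∈ range (N / 2 ^ i * 2 ^ i), z n with hS
  have h0 : ∑ n ∈ range N, z n = ∑ i ∈ range M, (S i - S (i + 1)) := by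
    rw [Finset.sum_range_sub']
    simp [hS, Nat.div_eq_of_lt hN]
  have h1 : ∀ i ∈ range M, ‖S i - S (i + 1)‖ ^ 2 ≤ ∑ a ∈ range (2 ^ (M - i)),
      ‖∑ n ∈ Ico (a * 2 ^ i) (a * 2 ^ i + 2 ^ i), z n‖ ^ 2 := by
    intro i hi
    have hi := Finset.mem_range.1 hi
    have hdiv : N / 2 ^ (i + 1) = N / 2 ^ i / 2 := by
      rw [pow_succ, Nat.div_div_eq_div_mul]
    have hlt : N / 2 ^ i < 2 ^ (M - i) := by
      rw [Nat.div_lt_iff_lt_mul (by positivity), ← pow_add]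
      rwa [Nat.sub_add_cancel hi.le]
    simp only [hS, hdiv]
    set u := N / 2 ^ i
    have hpow : u / 2 * 2 ^ (i + 1) = (u / 2 * 2) * 2 ^ i := by ring
    rw [hpow]
    rcases Nat.even_or_odd u with he | ho
    · rw [Nat.div_mul_cancel he.two_dvd, sub_self, norm_zero,
        zero_pow two_ne_zero]
      exact Finset.sum_nonneg fun _ _ => by positivity
    · obtain ⟨w, hw⟩ := ho
      have hw2 : u / 2 * 2 = 2 * w := by omega
      have hmem : 2 * w ∈ range (2 ^ (M - i)) := by
        rw [Finset.mem_range]; omega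
      rw [hw2, hw]
      refine le_trans (le_of_eq ?_) (Finset.single_le_sum (fun a _ => by positivity) hmem)
      rw [Finset.sum_Ico_eq_sub _ (Nat.le_add_right _ _), add_mul (2 * w), one_mul]
  have h2 : ‖∑ n ∈ range N, z n‖ ≤ ∑ i ∈ range M, ‖S i - S (i + 1)‖ := by
    rw [h0]; exact norm_sum_le _ _
  calc ‖∑ n ∈ range N, z n‖ ^ 2 ≤ (∑ i ∈ range M, ‖S i - S (i + 1)‖) ^ 2 := by gcongr
    _ ≤ M * ∑ i ∈ range M, ‖S i - S (i + 1)‖ ^ 2 := by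
      simpa using sq_sum_le_card_mul_sum_sq (s := range M) (f := fun i => ‖S i - S (i + 1)‖)
    _ ≤ _ := by
      gcongr with i hi
      exact h1 i hi

/-! ### Second moments over `α` and `β` -/

section SecondMoment

variable {p : ℕ} [Fact p.Prime] {F : Type*} [Field F] [Fintype F] [Algebra (ZMod p) F]

/-- Nondegeneracy of the trace makes the additive character primitive, so orthogonality in `α`
leaves only coinciding pairs. -/
theorem sum_norm_sq_sum_stdAddChar_trace [DecidableEq F] {ι : Type*} (z : ι → F) (W : Finset ι) :
    ∑ α : F, ‖∑ n ∈ W, (ZMod.stdAddChar (Algebra.trace (ZMod p) F (α * z n)) : ℂ)‖ ^ 2 =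
      Fintype.card F * ∑ n ∈ W, (#{n' ∈ W | z n = z n'} : ℝ) := by
  set Ψ : AddChar F ℂ := (ZMod.stdAddChar (N := p)).compAddMonoidHom
    (Algebra.trace (ZMod p) F).toAddMonoidHom with hΨ
  have hΨa : ∀ a, Ψ a = ZMod.stdAddChar (Algebra.trace (ZMod p) F a) := fun a => rfl
  have hprim : Ψ.IsPrimitive := by
    intro a ha h1
    have hchar : p = ringChar F := by
      have : CharP F p := charP_of_injective_algebraMap (algebraMap (ZMod p) F).injective p
      exact (ringChar.eq F p).symm
    subst hchar
    obtain ⟨b, hb⟩ := FiniteField.trace_to_zmod_nondegenerate F ha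
    have h2 := DFunLike.congr_fun h1 b
    rw [AddChar.mulShift_apply, AddChar.one_apply, hΨa,
      ← AddChar.map_zero_eq_one (ZMod.stdAddChar (N := ringChar F))] at h2
    apply hb
    convert ZMod.injective_stdAddChar h2
  have key : ((∑ α : F, ‖∑ n ∈ W, Ψ (α * z n)‖ ^ 2 : ℝ) : ℂ) =
      ∑ n ∈ W, ∑ n' ∈ W, ∑ α : F, Ψ (α * (z n - z n')) := by
    push_cast
    rw [Finset.sum_congr rfl fun n _ => Finset.sum_comm, Finset.sum_comm]
    refine Finset.sum_congr rfl fun α _ => ?_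
    rw [← Complex.mul_conj', map_sum, Finset.sum_mul_sum]
    refine Finset.sum_congr rfl fun n _ => Finset.sum_congr rfl fun n' _ => ?_
    rw [← AddChar.map_neg_eq_conj, ← AddChar.map_add_eq_mul]
    congr 1
    ring
  simp_rw [AddChar.sum_mulShift _ hprim, sub_eq_zero] at key
  have : ∑ α : F, ‖∑ n ∈ W, Ψ (α * z n)‖ ^ 2 =
      ∑ n ∈ W, ∑ n' ∈ W, if z n = z n' then (Fintype.card F : ℝ) else 0 := by
    apply Complex.ofReal_injective
    rw [key]
    push_cast
    refine Finset.sum_congr rfl fun n _ => Finset.sum_congr rfl fun n' _ => ?_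
    split_ifs <;> simp
  change ∑ α : F, ‖∑ n ∈ W, Ψ (α * z n)‖ ^ 2 = _
  rw [this, Finset.mul_sum]
  refine Finset.sum_congr rfl fun n _ => ?_
  rw [Finset.sum_ite, Finset.sum_const, Finset.sum_const_zero, add_zero, nsmul_eq_mul, mul_comm]

end SecondMoment

/-- Multiplication by `a` embeds the solutions into one residue class modulo `t` within an interval
of length `a * L`. No information about `gcd(a, t)` is needed. -/
theorem card_filter_pow_eq_le {F : Type*} [Field F] [DecidableEq F] {β : F} {t a : ℕ}
    (hβ : IsPrimitiveRoot β t) (ht : 0 < t) (ha : 0 < a) (n u L : ℕ) :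
    (#{n' ∈ Ico u (u + L) | β ^ (a * n) = β ^ (a * n')} : ℝ) ≤ 1 + L * a / t := by
  have hβ0 : β ≠ 0 := hβ.ne_zero ht.ne'
  have hsub : #{n' ∈ Ico u (u + L) | β ^ (a * n) = β ^ (a * n')} ≤
      #{x ∈ Ico (a * u) (a * (u + L)) | x ≡ a * n [MOD t]} := by
    refine Finset.card_le_card_of_injOn (fun n' => a * n') ?_ ?_
    · intro n' hn'
      simp only [Finset.coe_filter, Finset.mem_Ico, Set.mem_ofPred_eq] at hn' ⊢
      refine ⟨⟨by gcongr; exact hn'.1.1, by gcongr; exact hn'.1.2⟩, ?_⟩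
      have h1 : (Units.mk0 β hβ0) ^ (a * n) = (Units.mk0 β hβ0) ^ (a * n') := by
        ext; simpa using hn'.2
      rw [pow_eq_pow_iff_modEq] at h1
      have h2 : orderOf (Units.mk0 β hβ0) = t := by
        rw [← orderOf_units, Units.val_mk0, ← hβ.eq_orderOf]
      rw [h2] at h1
      exact h1.symm
    · intro x _ y _ hxy
      exact Nat.eq_of_mul_eq_mul_left ha hxy
  have ht' : (0 : ℚ) < t := by exact_mod_cast ht
  have hcard := Nat.Ico_filter_modEq_card (a * u) (a * (u + L)) ht (a * n)
  have hle : (#{x ∈ Ico (a * u) (a * (u + L)) | x ≡ a * n [MOD t]} : ℚ) ≤ 1 + L * a / t := by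
    have hnn : (0 : ℚ) ≤ 1 + L * a / t := by positivity
    have : ((#{x ∈ Ico (a * u) (a * (u + L)) | x ≡ a * n [MOD t]} : ℤ) : ℚ) ≤ 1 + L * a / t := by
      rw [hcard]
      push_cast
      rw [max_le_iff]
      refine ⟨?_, hnn⟩
      have h1 := Int.ceil_lt_add_one (((a : ℚ) * (u + L) - a * n) / t)
      have h2 := Int.le_ceil (((a : ℚ) * u - a * n) / t)
      have : ((a : ℚ) * (u + L) - a * n) / t = ((a : ℚ) * u - a * n) / t + L * a / t := by
        field_simp; ring
      linarith
    exact_mod_cast this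
  have hle' : (#{x ∈ Ico (a * u) (a * (u + L)) | x ≡ a * n [MOD t]} : ℝ) ≤ 1 + L * a / t := by
    have := (Rat.cast_le (K := ℝ)).2 hle
    push_cast at this
    exact this
  exact le_trans (by exact_mod_cast hsub) hle'

/-- The leading `r` digits of the `s` consecutive multistep numbers starting at the index
`b₁ * n + b₂`. -/
def digitTuple {p : ℕ} (k s r b₁ b₂ : ℕ) (y : ℕ → ZMod p) (n : ℕ) : Fin s → Fin r → ZMod p :=
  fun i j => y (k * (b₁ * n + b₂ + i) + j)

/-- The polynomial `∑ h_{ij} X^{ki+j}` attached to a frequency. -/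
noncomputable def freqPoly {p : ℕ} (F : Type*) [Field F] [Algebra (ZMod p) F] (k : ℕ) {s r : ℕ}
    (h : Fin s → Fin r → ZMod p) : Polynomial F :=
  ∑ i : Fin s, ∑ j : Fin r, Polynomial.monomial (k * (i : ℕ) + (j : ℕ)) (algebraMap (ZMod p) F (h i j))

/-- Since `j < r ≤ k`, the exponents `k * i + j` are pairwise distinct and no coefficients can
cancel. -/
theorem freqPoly_ne_zero {p : ℕ} [Fact p.Prime] (F : Type*) [Field F] [Algebra (ZMod p) F]
    {k s r : ℕ} (hr : r ≤ k) {h : Fin s → Fin r → ZMod p} (hh : h ≠ 0) : freqPoly F k h ≠ 0 := by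
  obtain ⟨i₀, hi₀⟩ := Function.ne_iff.1 hh
  obtain ⟨j₀, hj₀⟩ := Function.ne_iff.1 hi₀
  intro h0
  have hc := congrArg (fun P => P.coeff (k * (i₀ : ℕ) + j₀)) h0
  simp only [freqPoly, Polynomial.finsetSum_coeff, Polynomial.coeff_monomial,
    Polynomial.coeff_zero] at hc
  have inj : ∀ (i : Fin s) (j : Fin r), k * (i : ℕ) + j = k * (i₀ : ℕ) + j₀ → i = i₀ ∧ j = j₀ := by
    intro i j hij
    have hj : (j : ℕ) < k := j.2.trans_le hr
    have hj' : (j₀ : ℕ) < k := j₀.2.trans_le hr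
    have h1 : (i : ℕ) = i₀ := by
      have := congrArg (· / k) hij
      simpa [Nat.mul_add_div (Nat.zero_lt_of_lt hj), Nat.div_eq_of_lt hj, Nat.div_eq_of_lt hj']
        using this
    refine ⟨Fin.ext h1, Fin.ext ?_⟩
    rw [h1] at hij
    omega
  rw [Finset.sum_eq_single i₀, Finset.sum_eq_single j₀, if_pos rfl] at hc
  · exact hj₀ ((map_eq_zero _).1 hc)
  · intro j _ hj
    exact if_neg fun e => hj (inj _ _ e).2
  · simp
  · intro i _ hi
    exact Finset.sum_eq_zero fun j _ => if_neg fun e => hi (inj _ _ e).1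
  · simp

theorem natDegree_freqPoly_le {p : ℕ} (F : Type*) [Field F] [Algebra (ZMod p) F]
    {k s r : ℕ} (hr : r ≤ k) (h : Fin s → Fin r → ZMod p) :
    (freqPoly F k h).natDegree ≤ k * s := by
  refine Polynomial.natDegree_sum_le_of_forall_le _ _ fun i _ =>
    Polynomial.natDegree_sum_le_of_forall_le _ _ fun j _ =>
      (Polynomial.natDegree_monomial_le _).trans ?_
  calc k * (i : ℕ) + j ≤ k * (i : ℕ) + k := by have := j.2; omega
    _ = k * (i + 1) := by ring
    _ ≤ k * s := by gcongr; exact i.2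

section

variable {p : ℕ} [Fact p.Prime] {F : Type*} [Field F] [Algebra (ZMod p) F]

theorem boxChar_digitTuple (k b₁ b₂ : ℕ) {s r : ℕ} (h : Fin s → Fin r → ZMod p) (α β : F) (n : ℕ) :
    boxChar p h (digitTuple k s r b₁ b₂ (shiftRegister p α β) n) =
      ZMod.stdAddChar (Algebra.trace (ZMod p) F
        (α * (β ^ (k * (b₁ * n + b₂)) * (freqPoly F k h).eval β))) := by
  have h1 : ∀ (ι : Type) [Fintype ι] (g : ι → ZMod p),
      ∏ i, (ZMod.stdAddChar (g i) : ℂ) = ZMod.stdAddChar (∑ i, g i) := by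
    intro ι _ g
    exact (map_prod (ZMod.stdAddChar (N := p)).toMonoidHom (fun i => Multiplicative.ofAdd (g i)) univ).symm
  simp only [boxChar, digitChar, h1, digitTuple, shiftRegister]
  congr 1
  simp only [freqPoly, Polynomial.eval_finsetSum, Polynomial.eval_monomial, Finset.mul_sum,
    map_sum]
  refine Finset.sum_congr rfl fun i _ => Finset.sum_congr rfl fun j _ => ?_
  rw [← smul_eq_mul, ← map_smul, Algebra.smul_def]
  congr 1
  ring

variable [Fintype F]

theorem exists_isPrimitiveRoot_card_sub_one (F : Type*) [Field F] [Fintype F] :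
    ∃ β : F, IsPrimitiveRoot β (Fintype.card F - 1) := by
  classical
  obtain ⟨g, hg⟩ := IsCyclic.exists_generator (α := Fˣ)
  refine ⟨g, ?_⟩
  have h1 := orderOf_eq_card_of_forall_mem_zpowers hg
  rw [Nat.card_eq_fintype_card, Fintype.card_units] at h1
  rw [← h1, ← orderOf_units]
  exact IsPrimitiveRoot.orderOf _

theorem card_primitiveRoots_card_sub_one (F : Type*) [Field F] [Fintype F] :
    #(primitiveRoots (Fintype.card F - 1) F) = Nat.totient (Fintype.card F - 1) :=
  (exists_isPrimitiveRoot_card_sub_one F).choose_spec.card_primitiveRoots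

/-- The second moment of the exponential sums attached to the digits. -/
theorem sum_norm_sq_boxChar_le {k s r b₁ b₂ : ℕ} (hk : 0 < k) (hr : r ≤ k) (hb₁ : 0 < b₁)
    {h : Fin s → Fin r → ZMod p} (hh : h ≠ 0) (u L : ℕ) :
    ∑ β ∈ primitiveRoots (Fintype.card F - 1) F, ∑ α : F,
      ‖∑ n ∈ Ico u (u + L), boxChar p h (digitTuple k s r b₁ b₂ (shiftRegister p α β) n)‖ ^ 2 ≤
      Fintype.card F * Nat.totient (Fintype.card F - 1) * L *
        (1 + L * (k * b₁) / (Fintype.card F - 1 : ℕ) +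
          L * (k * s) / Nat.totient (Fintype.card F - 1)) := by
  classical
  have hq : 1 < Fintype.card F := Fintype.one_lt_card
  set q := Fintype.card F with hqdef
  set t := q - 1 with ht
  have ht0 : 0 < t := by omega
  have hφ : 0 < Nat.totient t := Nat.totient_pos.2 ht0
  have hφ' : (0 : ℝ) < Nat.totient t := by exact_mod_cast hφ
  have ht' : (0 : ℝ) < t := by exact_mod_cast ht0
  have hcard : #(primitiveRoots t F) = Nat.totient t := card_primitiveRoots_card_sub_one F
  set P := freqPoly F k h with hP
  have hP0 : P ≠ 0 := freqPoly_ne_zero F hr hh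
  -- When `P` vanishes at `β` every pair coincides and only the trivial bound `q * L * L` is
  -- available; this happens for at most `k * s` values of `β`.
  have step : ∀ β ∈ primitiveRoots t F, ∑ α : F,
      ‖∑ n ∈ Ico u (u + L), boxChar p h (digitTuple k s r b₁ b₂ (shiftRegister p α β) n)‖ ^ 2 ≤
      q * L * (1 + L * (k * b₁) / t) + if P.eval β = 0 then (q * L * L : ℝ) else 0 := by
    intro β hβ
    rw [mem_primitiveRoots ht0] at hβ
    simp_rw [boxChar_digitTuple]
    rw [sum_norm_sq_sum_stdAddChar_trace, ← hqdef]
    split_ifs with h0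
    · have hb : ∑ n ∈ Ico u (u + L), (#{n' ∈ Ico u (u + L) |
          β ^ (k * (b₁ * n + b₂)) * P.eval β = β ^ (k * (b₁ * n' + b₂)) * P.eval β} : ℝ) ≤
          ∑ n ∈ Ico u (u + L), (L : ℝ) := by
        refine Finset.sum_le_sum fun n _ => ?_
        have := Finset.card_filter_le (Ico u (u + L))
          (fun n' => β ^ (k * (b₁ * n + b₂)) * P.eval β = β ^ (k * (b₁ * n' + b₂)) * P.eval β)
        rw [Nat.card_Ico, Nat.add_sub_cancel_left] at this
        exact_mod_cast this
      rw [Finset.sum_const, Nat.card_Ico, Nat.add_sub_cancel_left, nsmul_eq_mul] at hb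
      have h1 := mul_le_mul_of_nonneg_left hb (Nat.cast_nonneg (α := ℝ) q)
      have h2 : (0 : ℝ) ≤ q * L * (1 + L * (k * b₁) / t) := by positivity
      linarith
    · rw [add_zero, mul_assoc]
      refine mul_le_mul_of_nonneg_left ?_ (Nat.cast_nonneg q)
      have hβ0 : β ≠ 0 := hβ.ne_zero ht0.ne'
      have hb : ∑ n ∈ Ico u (u + L), (#{n' ∈ Ico u (u + L) |
          β ^ (k * (b₁ * n + b₂)) * P.eval β = β ^ (k * (b₁ * n' + b₂)) * P.eval β} : ℝ) ≤
          ∑ n ∈ Ico u (u + L), (1 + L * (k * b₁) / t : ℝ) := by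
        refine Finset.sum_le_sum fun n _ => ?_
        have h1 := card_filter_pow_eq_le hβ ht0 (Nat.mul_pos hk hb₁) n u L
        push_cast at h1
        refine le_of_eq_of_le ?_ h1
        congr 2
        refine Finset.filter_congr fun n' _ => ?_
        rw [mul_left_inj' h0, mul_add, mul_add, pow_add, pow_add,
          mul_left_inj' (pow_ne_zero _ hβ0), mul_assoc, mul_assoc]
      rwa [Finset.sum_const, Nat.card_Ico, Nat.add_sub_cancel_left, nsmul_eq_mul] at hb
  refine (Finset.sum_le_sum step).trans ?_
  rw [Finset.sum_add_distrib, Finset.sum_const, hcard, nsmul_eq_mul, ← Finset.sum_filter,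
    Finset.sum_const, nsmul_eq_mul]
  have hroots : #{β ∈ primitiveRoots t F | P.eval β = 0} ≤ k * s := by
    calc _ ≤ #P.roots.toFinset := Finset.card_le_card fun β hβ => by
          rw [Multiset.mem_toFinset, Polynomial.mem_roots hP0]
          exact (Finset.mem_filter.1 hβ).2
      _ ≤ P.roots.card := Multiset.toFinset_card_le _
      _ ≤ P.natDegree := P.card_roots'
      _ ≤ k * s := natDegree_freqPoly_le F hr h
  have hroots' : (#{β ∈ primitiveRoots t F | P.eval β = 0} : ℝ) ≤ k * s := by
    exact_mod_cast hroots
  have h1 := mul_le_mul_of_nonneg_right hroots' (by positivity : (0 : ℝ) ≤ q * L * L)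
  have e : (q : ℝ) * Nat.totient t * L * (1 + L * (k * b₁) / t + L * (k * s) / Nat.totient t) =
      Nat.totient t * (q * L * (1 + L * (k * b₁) / t)) + k * s * (q * L * L) := by
    field_simp
  rw [e]
  linarith

end

/-! ### Euler's function and the choice of parameters -/

/-- In increasing order the `i`-th element is at least `i + 1`, so the product is at least the
telescoping product of the `1 - 1 / (i + 1)`. -/
theorem inv_card_add_one_le_prod_one_sub_inv (S : Finset ℕ) (hS : ∀ n ∈ S, 2 ≤ n) :
    ((#S : ℚ) + 1)⁻¹ ≤ ∏ n ∈ S, (1 - (n : ℚ)⁻¹) := by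
  induction S using Finset.induction_on_max with
  | empty => simp
  | insert a S ha ih =>
    have haS : a ∉ S := fun h => lt_irrefl _ (ha a h)
    rw [Finset.prod_insert haS, Finset.card_insert_of_notMem haS]
    have ih := ih fun n hn => hS n (Finset.mem_insert_of_mem hn)
    have ha2 : 2 ≤ a := hS a (Finset.mem_insert_self _ _)
    have hcard : #S + 2 ≤ a := by
      have : S ⊆ Ico 2 a := fun n hn =>
        Finset.mem_Ico.2 ⟨hS n (Finset.mem_insert_of_mem hn), ha n hn⟩
      have := Finset.card_le_card this
      rw [Nat.card_Ico] at this
      omega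
    have hcard' : (#S : ℚ) + 2 ≤ a := by exact_mod_cast hcard
    have h1 : (a : ℚ)⁻¹ ≤ ((#S : ℚ) + 2)⁻¹ := inv_anti₀ (by positivity) hcard'
    have h2 : (((#S + 1 : ℕ) : ℚ) + 1)⁻¹ = (1 - ((#S : ℚ) + 2)⁻¹) * ((#S : ℚ) + 1)⁻¹ := by
      push_cast
      field_simp
      ring
    rw [h2]
    have h3 : (0 : ℚ) ≤ 1 - ((#S : ℚ) + 2)⁻¹ := by
      rw [sub_nonneg]
      exact inv_le_one_of_one_le₀ (by linarith [(Nat.cast_nonneg (α := ℚ) #S)])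
    gcongr
    linarith

/-- An elementary lower bound for Euler's function. -/
theorem le_totient_mul_one_add_log {n : ℕ} (hn : n ≠ 0) :
    n ≤ Nat.totient n * (1 + Nat.log 2 n) := by
  have h1 := Nat.totient_eq_mul_prod_factors n
  have h2 := inv_card_add_one_le_prod_one_sub_inv n.primeFactors
    fun p hp => (Nat.prime_of_mem_primeFactors hp).two_le
  have h3 : #n.primeFactors ≤ Nat.log 2 n := by
    apply Nat.le_log_of_pow_le one_lt_two
    calc 2 ^ #n.primeFactors ≤ ∏ p ∈ n.primeFactors, p :=
          Finset.pow_card_le_prod _ _ _ fun p hp => (Nat.prime_of_mem_primeFactors hp).two_le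
      _ ≤ n := Nat.le_of_dvd (Nat.pos_of_ne_zero hn) (Nat.prod_primeFactors_dvd n)
  have h3' : (#n.primeFactors : ℚ) ≤ Nat.log 2 n := by exact_mod_cast h3
  have h4 : (n : ℚ) ≤ Nat.totient n * (1 + Nat.log 2 n) := by
    rw [h1]
    have h5 : (1 : ℚ) ≤ (∏ p ∈ n.primeFactors, (1 - (p : ℚ)⁻¹)) * (1 + Nat.log 2 n) := by
      calc (1 : ℚ) = ((#n.primeFactors : ℚ) + 1)⁻¹ * (1 + #n.primeFactors) := by
            field_simp; ring
        _ ≤ _ := mul_le_mul h2 (by linarith) (by positivity) (le_trans (by positivity) h2)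
    nlinarith [(Nat.cast_nonneg (α := ℚ) n)]
  exact_mod_cast h4

theorem one_add_sq_le_four_mul_two_pow (d : ℕ) : (1 + d) ^ 2 ≤ 4 * 2 ^ d := by
  induction d with
  | zero => norm_num
  | succ d ih =>
    rw [pow_succ 2 d]
    rcases Nat.lt_or_ge d 2 with h | h
    · interval_cases d <;> norm_num
    · nlinarith

/-- Makes the second moment independent of `q`. Both `k` and the loss in Euler's function are
logarithmic in `q`; when `q` is much larger than `2 ^ m`, the surplus in `q` absorbs them. -/
theorem moment_factor_le {p k m L b s : ℕ} (hp : 2 ≤ p) (hk : 1 ≤ k) (hm : 2 ^ m ≤ p ^ k)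
    (hL : L ≤ 2 ^ (m + 1)) (hb : 1 ≤ b) (hs : 1 ≤ s) :
    1 + L * (k * b) / (p ^ k - 1 : ℕ) + L * (k * s) / Nat.totient (p ^ k - 1) ≤
      (33 * b * s * (m + 1) ^ 2 : ℝ) := by
  set q := p ^ k with hq
  set t := q - 1 with ht
  have hkq : 2 ^ k ≤ q := Nat.pow_le_pow_left hp k
  have hq2 : 2 ≤ q := le_trans (by simpa using Nat.pow_le_pow_right two_pos hk) hkq
  have ht0 : 0 < t := by omega
  set l := Nat.log 2 q with hl
  have hkl : k ≤ l := Nat.le_log_of_pow_le one_lt_two hkq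
  have hml : m ≤ l := Nat.le_log_of_pow_le one_lt_two hm
  have hlq : 2 ^ l ≤ q := Nat.pow_log_le_self 2 (by omega)
  have htot := le_totient_mul_one_add_log ht0.ne'
  have hlog : Nat.log 2 t ≤ l := Nat.log_mono_right (by omega)
  have hφ0 : 0 < Nat.totient t := Nat.totient_pos.2 ht0
  have hφt : Nat.totient t ≤ t := Nat.totient_le t
  -- With `l = m + d`, one has `(1 + l)^2 ≤ (1 + m)^2 (1 + d)^2`, and the factor in `d` is absorbed
  -- by `2 ^ d`.
  have main : 2 ^ m * k ≤ 8 * (m + 1) ^ 2 * Nat.totient t := by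
    obtain ⟨d, hd⟩ := Nat.exists_eq_add_of_le hml
    have h1 : t ≤ Nat.totient t * (1 + l) := htot.trans (by gcongr)
    have h2 : q ≤ 2 * (Nat.totient t * (1 + l)) := by omega
    have h3 : 2 ^ d * (2 ^ m * k) ≤ 2 ^ d * (8 * (m + 1) ^ 2 * Nat.totient t) := by
      calc 2 ^ d * (2 ^ m * k) = 2 ^ l * k := by rw [hd, pow_add]; ring
        _ ≤ (2 * (Nat.totient t * (1 + l))) * (1 + l) := by
          gcongr
          · exact hlq.trans h2
          · omega
        _ = 2 * Nat.totient t * (1 + l) ^ 2 := by ring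
        _ ≤ 2 * Nat.totient t * ((m + 1) ^ 2 * (1 + d) ^ 2) := by
          gcongr
          rw [← mul_pow]
          gcongr
          rw [hd]
          nlinarith [Nat.zero_le (m * d)]
        _ ≤ 2 * Nat.totient t * ((m + 1) ^ 2 * (4 * 2 ^ d)) := by
          gcongr
          exact one_add_sq_le_four_mul_two_pow d
        _ = _ := by ring
    exact Nat.le_of_mul_le_mul_left h3 (by positivity)
  have hφ0' : (0 : ℝ) < Nat.totient t := by exact_mod_cast hφ0
  have hφt' : (Nat.totient t : ℝ) ≤ t := by exact_mod_cast hφt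
  have main' : (2 : ℝ) ^ m * k ≤ 8 * (m + 1) ^ 2 * Nat.totient t := by exact_mod_cast main
  have hL' : (L : ℝ) ≤ 2 * 2 ^ m := by
    have : (L : ℝ) ≤ 2 ^ (m + 1) := by exact_mod_cast hL
    rw [pow_succ] at this; linarith
  have hb' : (1 : ℝ) ≤ b := by exact_mod_cast hb
  have hs' : (1 : ℝ) ≤ s := by exact_mod_cast hs
  have hLk : (L : ℝ) * k ≤ 16 * (m + 1) ^ 2 * Nat.totient t := by
    have := mul_le_mul_of_nonneg_right hL' (Nat.cast_nonneg (α := ℝ) k)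
    linarith
  have term : ∀ (c : ℝ), 0 ≤ c → L * (k * c) / Nat.totient t ≤ 16 * (m + 1) ^ 2 * c := by
    intro c hc
    rw [div_le_iff₀ hφ0']
    have := mul_le_mul_of_nonneg_right hLk hc
    linarith
  have h1 : (L : ℝ) * (k * b) / t ≤ 16 * (m + 1) ^ 2 * b :=
    le_trans (by gcongr) (term b (by positivity))
  have h2 := term s (by positivity)
  have h3 : (1 : ℝ) ≤ ((m : ℝ) + 1) ^ 2 := by
    have : (0 : ℝ) ≤ m := by positivity
    nlinarith
  have h4 : (b : ℝ) + s ≤ 2 * (b * s) := by nlinarith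
  have h5 : (1 : ℝ) ≤ b * s := by nlinarith
  have h6 : 16 * ((m : ℝ) + 1) ^ 2 * (b + s) ≤ 16 * ((m : ℝ) + 1) ^ 2 * (2 * (b * s)) := by gcongr
  have h7 : (1 : ℝ) ≤ ((m : ℝ) + 1) ^ 2 * (b * s) := by nlinarith
  linarith

/-- The parameters of the digital Erdős–Turán–Koksma inequality for about `2 ^ m` points. -/
theorem exists_digit_parameters {p k m : ℕ} (hp : 2 ≤ p) (hk : 1 ≤ k) (hm : 2 ^ m ≤ p ^ k) :
    ∃ r J T : ℕ, r + 1 ≤ k ∧ 1 ≤ J ∧ p ≤ T * J ∧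
      (2 * J / (p : ℝ) ^ (r + 1) : ℝ) * √(2 ^ (m + 1)) ≤ 6 ∧
      r * (3 + 2 * Real.log p) + (3 + 2 * Real.log T) ≤ 7 * ((m : ℝ) + 1) := by
  -- `R` is the target resolution, about `√N`; `p ^ r ≤ R < p ^ (r + 1)`, and `J` coarsens the last
  -- digit so that `J / p ^ (r + 1)` is of order `1 / R`. Then `T = 2 * R` suffices because `p ≤ p ^
  -- (r + 1) < (J + 1) * R ≤ 2 * J * R`. For `p > R` a single smoothed digit remains (`r = 0`).
  set R := Nat.sqrt (2 ^ m) with hR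
  have hR1 : 1 ≤ R := Nat.le_sqrt'.2 (by simpa using Nat.one_le_two_pow)
  have hRR : R * R ≤ 2 ^ m := Nat.sqrt_le _
  have hRR' : 2 ^ m < (R + 1) * (R + 1) := Nat.lt_succ_sqrt _
  have hpk : 2 ≤ p ^ k := by
    calc 2 ≤ p := hp
      _ = p ^ 1 := (pow_one p).symm
      _ ≤ p ^ k := Nat.pow_le_pow_right (by omega) hk
  have hRq : R < p ^ k := by
    by_contra hcon
    push Not at hcon
    nlinarith
  set r := Nat.log p R with hr
  have hrR : p ^ r ≤ R := Nat.pow_log_le_self p (by omega)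
  have hRr : R < p ^ (r + 1) := Nat.lt_pow_succ_log_self (by omega) R
  set J := p ^ (r + 1) / R with hJ
  have hJ1 : 1 ≤ J := (Nat.one_le_div_iff (by omega)).2 hRr.le
  have hJR : J * R ≤ p ^ (r + 1) := Nat.div_mul_le_self _ _
  have hJR' : p ^ (r + 1) < (J + 1) * R := by
    have := Nat.lt_div_mul_add (a := p ^ (r + 1)) (b := R) (by omega)
    rw [add_mul, one_mul]
    exact this
  have hR0 : (0 : ℝ) < R := by exact_mod_cast hR1
  have hp0 : (0 : ℝ) < p := by exact_mod_cast (by omega : 0 < p)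
  refine ⟨r, J, 2 * R, ?_, hJ1, ?_, ?_, ?_⟩
  · exact (Nat.pow_lt_pow_iff_right (by omega : 1 < p)).1 (hrR.trans_lt hRq)
  · have h1 : p ≤ p ^ (r + 1) := Nat.le_self_pow (by omega) p
    nlinarith
  · have h1 : √((2 : ℝ) ^ (m + 1)) ≤ 3 * R := by
      rw [Real.sqrt_le_left (by positivity)]
      have h2 : (2 : ℝ) ^ m ≤ (R + 1) * (R + 1) := by exact_mod_cast hRR'.le
      have h3 : (1 : ℝ) ≤ R := by exact_mod_cast hR1
      rw [pow_succ]
      nlinarith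
    have h2 : (J : ℝ) * R ≤ (p : ℝ) ^ (r + 1) := by exact_mod_cast hJR
    calc (2 * J / (p : ℝ) ^ (r + 1) : ℝ) * √(2 ^ (m + 1))
        ≤ (2 * J / (p : ℝ) ^ (r + 1) : ℝ) * (3 * R) := by gcongr
      _ = 6 * (J * R / (p : ℝ) ^ (r + 1)) := by ring
      _ ≤ 6 * 1 := by
        gcongr
        rw [div_le_one (by positivity)]
        exact h2
      _ = 6 := by norm_num
  · have hlog2 : Real.log 2 ≤ 1 := by linarith [Real.log_two_lt_d9]
    have hm0 : (0 : ℝ) ≤ m := by positivity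
    have h1 : 2 * Real.log R ≤ m := by
      have : (R : ℝ) ^ 2 ≤ 2 ^ m := by rw [pow_two]; exact_mod_cast hRR
      have := Real.log_le_log (by positivity) this
      rw [Real.log_pow, Real.log_pow] at this
      push_cast at this
      nlinarith
    have h2 : r * Real.log p ≤ Real.log R := by
      rw [← Real.log_pow]
      exact Real.log_le_log (by positivity) (by exact_mod_cast hrR)
    have h3 : r ≤ m := by
      have : 2 ^ r ≤ 2 ^ m := by
        calc 2 ^ r ≤ p ^ r := Nat.pow_le_pow_left hp r
          _ ≤ R := hrR
          _ ≤ R * R := Nat.le_mul_self R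
          _ ≤ 2 ^ m := hRR
      exact (Nat.pow_le_pow_iff_right (by norm_num)).1 this
    have h3' : (r : ℝ) ≤ m := by exact_mod_cast h3
    push_cast
    rw [Real.log_mul two_ne_zero hR0.ne']
    linarith

/-! ### The discrepancy at one dyadic scale -/

/-- For `2 ^ m ≤ N < 2 ^ (m + 1)` the discrepancy of the multistep points is controlled by a random
variable, independent of `N`, with a small mean over the pairs `(α, β)`. -/
theorem exists_discrepancy_majorant {p k s m b₁ : ℕ} [Fact p.Prime] {F : Type*} [Field F]
    [Fintype F] [Algebra (ZMod p) F] (hF : Fintype.card F = p ^ k) (hk : 1 ≤ k) (hs : 1 ≤ s)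
    (hm : 2 ^ m ≤ p ^ k) (hb₁ : 1 ≤ b₁) (b₂ : ℕ) :
    ∃ X : F → F → ℝ, (∀ α β, 0 ≤ X α β) ∧
      (∀ α β N, 2 ^ m ≤ N → N < 2 ^ (m + 1) →
        discrepancy (fun n => overlappingTuple s (multistep p k (shiftRegister p α β))
          (b₁ * n + b₂)) N ≤ (6 * s + √(X α β)) / √N) ∧
      ∑ β ∈ primitiveRoots (p ^ k - 1) F, ∑ α, X α β ≤
        ((p ^ k : ℕ) : ℝ) * Nat.totient (p ^ k - 1) *
          (66 * 49 ^ s * b₁ * s * ((m : ℝ) + 1) ^ (2 * s + 4)) := by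
  have hp2 : 2 ≤ p := (Fact.out : p.Prime).two_le
  obtain ⟨r, J, T, hrk, hJ, hT, hδ, hw⟩ := exists_digit_parameters hp2 hk hm
  set v : F → F → ℕ → Fin s → Fin (r + 1) → ZMod p :=
    fun α β => digitTuple k s (r + 1) b₁ b₂ (shiftRegister p α β) with hv
  set W : ℝ := ∑ h : Fin s → Fin (r + 1) → ZMod p, boxWeight p T r h with hW
  have hW0 : 0 ≤ W := Finset.sum_nonneg fun _ _ => boxWeight_nonneg _ _ _ _
  have hWle : W ≤ (7 * ((m : ℝ) + 1)) ^ s := by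
    rw [hW, sum_boxWeight]
    have h1 : 0 ≤ ∑ h, digitWeight p T r h := Finset.sum_nonneg fun _ _ => digitWeight_nonneg _ _ _ _
    exact pow_le_pow_left₀ h1 ((sum_digitWeight_le p T r).trans hw) s
  -- `Q` bounds the squared character sum for every `N < 2 ^ (m + 1)` at once.
  set Q : (Fin s → Fin (r + 1) → ZMod p) → F → F → ℝ := fun h α β =>
    (m + 1 : ℕ) * ∑ i ∈ range (m + 1), ∑ a ∈ range (2 ^ (m + 1 - i)),
      ‖∑ n ∈ Ico (a * 2 ^ i) (a * 2 ^ i + 2 ^ i), boxChar p h (v α β n)‖ ^ 2 with hQ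
  have hQ0 : ∀ h α β, 0 ≤ Q h α β := fun h α β => by positivity
  have hwerase : ∑ h ∈ univ.erase (0 : Fin s → Fin (r + 1) → ZMod p), boxWeight p T r h ≤ W :=
    Finset.sum_le_sum_of_subset_of_nonneg (Finset.erase_subset _ _)
      fun _ _ _ => boxWeight_nonneg _ _ _ _
  -- Cauchy–Schwarz with the weights bounds the square of the weighted character sum by `W` times
  -- the weighted sum of `Q`; division by `2 ^ m ≤ N` normalises it. In the mean, `W * W` gives `49
  -- ^ s (m + 1)^(2 s)`, the dyadic decomposition and `moment_factor_le` give `(m + 1)^2` each, and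
  -- `66 = 2 * 33`.
  refine ⟨fun α β => (W * ∑ h ∈ univ.erase 0, boxWeight p T r h * Q h α β) / 2 ^ m,
    fun α β => ?_, fun α β N hN1 hN2 => ?_, ?_⟩
  · have : 0 ≤ ∑ h ∈ univ.erase 0, boxWeight p T r h * Q h α β :=
      Finset.sum_nonneg fun h _ => mul_nonneg (boxWeight_nonneg _ _ _ _) (hQ0 _ _ _)
    positivity
  · have hN0 : 1 ≤ N := le_trans Nat.one_le_two_pow hN1
    have hN0' : (0 : ℝ) < N := by exact_mod_cast hN0
    have hN1' : (2 : ℝ) ^ m ≤ N := by exact_mod_cast hN1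
    refine (discrepancy_le hJ hT _ (v α β) (fun n i => ?_) hN0).trans ?_
    · exact digitVal_le_multistep_mul hrk (shiftRegister p α β) (b₁ * n + b₂ + i)
    set E := ∑ h ∈ univ.erase 0, boxWeight p T r h * ‖∑ n ∈ range N, boxChar p h (v α β n)‖ with hE
    set Y := ∑ h ∈ univ.erase 0, boxWeight p T r h * Q h α β with hY
    have hY0 : 0 ≤ Y :=
      Finset.sum_nonneg fun h _ => mul_nonneg (boxWeight_nonneg _ _ _ _) (hQ0 _ _ _)
    have hE2 : E ^ 2 ≤ W * Y := by
      calc E ^ 2 ≤ (∑ h ∈ univ.erase 0, boxWeight p T r h) *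
            ∑ h ∈ univ.erase 0, boxWeight p T r h *
              ‖∑ n ∈ range N, boxChar p h (v α β n)‖ ^ 2 :=
            Finset.sum_sq_le_sum_mul_sum_of_sq_le_mul _ (fun h _ => boxWeight_nonneg _ _ _ _)
              (fun h _ => mul_nonneg (boxWeight_nonneg _ _ _ _) (by positivity))
              (fun h _ => by rw [mul_pow, pow_two (boxWeight p T r h), mul_assoc])
        _ ≤ W * Y := by
          refine mul_le_mul hwerase (Finset.sum_le_sum fun h _ => ?_) (Finset.sum_nonneg
            fun h _ => mul_nonneg (boxWeight_nonneg _ _ _ _) (by positivity)) hW0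
          exact mul_le_mul_of_nonneg_left (norm_sum_range_sq_le_dyadic _ hN2)
            (boxWeight_nonneg _ _ _ _)
    have hsqN : √(N : ℝ) * √(N : ℝ) = N := Real.mul_self_sqrt hN0'.le
    have hsq0 : 0 < √(N : ℝ) := Real.sqrt_pos.2 hN0'
    have hE3 : E ≤ √(W * Y / 2 ^ m) * √N := by
      rw [← Real.sqrt_mul (by positivity)]
      apply Real.le_sqrt_of_sq_le
      refine hE2.trans ?_
      rw [div_mul_eq_mul_div, le_div_iff₀ (by positivity)]
      gcongr
    have hδ' : (2 * J / (p : ℝ) ^ (r + 1) : ℝ) * √N ≤ 6 := by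
      refine le_trans ?_ hδ
      gcongr
      exact_mod_cast hN2.le
    rw [le_div_iff₀ hsq0, add_mul]
    have h1 : E / N * √N ≤ √(W * Y / 2 ^ m) := by
      rw [div_mul_eq_mul_div, div_le_iff₀ hN0']
      calc E * √N ≤ √(W * Y / 2 ^ m) * √N * √N := by gcongr
        _ = _ := by rw [mul_assoc, hsqN]
    have h2 : (s : ℝ) * (2 * J / (p : ℝ) ^ (r + 1)) * √N ≤ 6 * s := by
      rw [mul_assoc, mul_comm (6 : ℝ)]
      gcongr
    linarith
  · set K : ℝ := 33 * b₁ * s * ((m : ℝ) + 1) ^ 2 with hK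
    set Φ : ℝ := ((p ^ k : ℕ) : ℝ) * Nat.totient (p ^ k - 1) with hΦ
    have hQsum : ∀ h ∈ univ.erase 0, ∑ β ∈ primitiveRoots (p ^ k - 1) F, ∑ α, Q h α β ≤
        Φ * (((m : ℝ) + 1) ^ 2 * 2 ^ (m + 1) * K) := by
      intro h hh
      have hblock : ∀ i ∈ range (m + 1), ∀ a ∈ range (2 ^ (m + 1 - i)),
          ∑ β ∈ primitiveRoots (p ^ k - 1) F, ∑ α,
            ‖∑ n ∈ Ico (a * 2 ^ i) (a * 2 ^ i + 2 ^ i), boxChar p h (v α β n)‖ ^ 2 ≤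
            Φ * 2 ^ i * K := by
        intro i hi a _
        have h1 := sum_norm_sq_boxChar_le (p := p) (F := F) (b₂ := b₂) hk hrk hb₁
          (Finset.ne_of_mem_erase hh) (a * 2 ^ i) (2 ^ i)
        rw [hF] at h1
        refine h1.trans ?_
        have hi' : i ≤ m + 1 := (Finset.mem_range.1 hi).le
        have h2 := moment_factor_le (L := 2 ^ i) hp2 hk hm
          (Nat.pow_le_pow_right two_pos hi') hb₁ hs
        rw [Nat.cast_pow 2 i] at h2 ⊢
        rw [Nat.cast_two] at h2 ⊢
        gcongr
      have hswap : ∑ β ∈ primitiveRoots (p ^ k - 1) F, ∑ α, Q h α β =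
          (m + 1 : ℕ) * ∑ i ∈ range (m + 1), ∑ a ∈ range (2 ^ (m + 1 - i)),
            ∑ β ∈ primitiveRoots (p ^ k - 1) F, ∑ α,
              ‖∑ n ∈ Ico (a * 2 ^ i) (a * 2 ^ i + 2 ^ i), boxChar p h (v α β n)‖ ^ 2 := by
        simp only [hQ, ← Finset.mul_sum]
        congr 1
        rw [Finset.sum_congr rfl fun β _ => Finset.sum_comm, Finset.sum_comm]
        refine Finset.sum_congr rfl fun i _ => ?_
        rw [Finset.sum_congr rfl fun β _ => Finset.sum_comm, Finset.sum_comm]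
      rw [hswap]
      calc _ ≤ (m + 1 : ℕ) * ∑ i ∈ range (m + 1), ∑ a ∈ range (2 ^ (m + 1 - i)),
            Φ * 2 ^ i * K := by
            gcongr with i hi a ha
            exact hblock i hi a ha
        _ = (m + 1 : ℕ) * ∑ i ∈ range (m + 1), Φ * 2 ^ (m + 1) * K := by
            congr 1
            refine Finset.sum_congr rfl fun i hi => ?_
            have hi' : i ≤ m + 1 := (Finset.mem_range.1 hi).le
            rw [Finset.sum_const, Finset.card_range, nsmul_eq_mul, Nat.cast_pow, Nat.cast_two]
            have : (2 : ℝ) ^ (m + 1) = 2 ^ (m + 1 - i) * 2 ^ i := by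
              rw [← pow_add]; congr 1; omega
            rw [this]
            ring
        _ = _ := by
            rw [Finset.sum_const, Finset.card_range, nsmul_eq_mul]
            push_cast
            ring
    have hswap : ∑ β ∈ primitiveRoots (p ^ k - 1) F, ∑ α,
        (W * ∑ h ∈ univ.erase 0, boxWeight p T r h * Q h α β) / 2 ^ m =
        (W * ∑ h ∈ univ.erase 0, boxWeight p T r h *
          ∑ β ∈ primitiveRoots (p ^ k - 1) F, ∑ α, Q h α β) / 2 ^ m := by
      simp only [← Finset.sum_div, ← Finset.mul_sum]
      congr 2
      rw [Finset.sum_congr rfl fun β _ => Finset.sum_comm, Finset.sum_comm]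
      simp only [← Finset.mul_sum]
    rw [hswap]
    have hΦ0 : 0 ≤ Φ := by positivity
    have hK0 : 0 ≤ K := by positivity
    have h1 : ∑ h ∈ univ.erase 0, boxWeight p T r h *
        ∑ β ∈ primitiveRoots (p ^ k - 1) F, ∑ α, Q h α β ≤
        W * (Φ * (((m : ℝ) + 1) ^ 2 * 2 ^ (m + 1) * K)) := by
      calc _ ≤ ∑ h ∈ univ.erase 0, boxWeight p T r h *
            (Φ * (((m : ℝ) + 1) ^ 2 * 2 ^ (m + 1) * K)) :=
            Finset.sum_le_sum fun h hh =>
              mul_le_mul_of_nonneg_left (hQsum h hh) (boxWeight_nonneg _ _ _ _)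
        _ ≤ _ := by
            rw [← Finset.sum_mul]
            gcongr
    have hW2 : W * W ≤ 49 ^ s * ((m : ℝ) + 1) ^ (2 * s) := by
      calc W * W ≤ (7 * ((m : ℝ) + 1)) ^ s * (7 * ((m : ℝ) + 1)) ^ s := by gcongr
        _ = (49 * ((m : ℝ) + 1) ^ 2) ^ s := by rw [← mul_pow]; congr 1; ring
        _ = _ := by rw [mul_pow, ← pow_mul]
    rw [div_le_iff₀ (by positivity)]
    calc _ ≤ W * (W * (Φ * (((m : ℝ) + 1) ^ 2 * 2 ^ (m + 1) * K))) := by gcongr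
      _ = (W * W) * (Φ * (((m : ℝ) + 1) ^ 2 * 2 ^ (m + 1) * K)) := by ring
      _ ≤ (49 ^ s * ((m : ℝ) + 1) ^ (2 * s)) * (Φ * (((m : ℝ) + 1) ^ 2 * 2 ^ (m + 1) * K)) := by
        gcongr
      _ = _ := by rw [hK, pow_succ (2 : ℝ) m, pow_add _ (2 * s) 4]; ring

/-! ### Summable weights and Markov's inequality -/

/-- The terms are dominated by the telescoping differences `1 / log (m + 2) - 1 / log (m + 3)`, with
total at most `1 / log 2`. -/
theorem sum_range_inv_mul_log_sq_le (n : ℕ) :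
    ∑ m ∈ range n, 1 / (((m : ℝ) + 3) * Real.log (m + 3) ^ 2) ≤ 2 := by
  have hlog : ∀ m : ℕ, 0 < Real.log ((m : ℝ) + 2) := fun m =>
    Real.log_pos (by have : (0 : ℝ) ≤ m := Nat.cast_nonneg m; linarith)
  have key : ∑ m ∈ range n, 1 / (((m : ℝ) + 3) * Real.log (m + 3) ^ 2) ≤
      1 / Real.log 2 - 1 / Real.log (n + 2) := by
    induction n with
    | zero => simp
    | succ n ih =>
      rw [Finset.sum_range_succ]
      have hn : (0 : ℝ) ≤ n := Nat.cast_nonneg n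
      have ha := hlog n
      have hb : 0 < Real.log ((n : ℝ) + 3) := Real.log_pos (by linarith)
      have hba : 1 / ((n : ℝ) + 3) ≤ Real.log (n + 3) - Real.log (n + 2) := by
        rw [← Real.log_div (by linarith) (by linarith)]
        refine le_trans (le_of_eq ?_) (Real.one_sub_inv_le_log_of_pos (by positivity))
        field_simp
        ring
      have hle : Real.log ((n : ℝ) + 2) ≤ Real.log (n + 3) := by
        have : 0 ≤ 1 / ((n : ℝ) + 3) := by positivity
        linarith
      have h1 : 1 / (((n : ℝ) + 3) * Real.log (n + 3) ^ 2) ≤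
          1 / Real.log (n + 2) - 1 / Real.log (n + 3) := by
        rw [div_sub_div _ _ ha.ne' hb.ne', one_mul, mul_one, ← div_div, div_le_div_iff₀
          (by positivity) (by positivity)]
        calc 1 / ((n : ℝ) + 3) * (Real.log (n + 2) * Real.log (n + 3))
            ≤ (Real.log (n + 3) - Real.log (n + 2)) * (Real.log (n + 3) * Real.log (n + 3)) := by
              gcongr
          _ = _ := by ring
      have e : ((n + 1 : ℕ) : ℝ) + 2 = n + 3 := by push_cast; ring
      rw [e]
      linarith
  have h2 : 0 < 1 / Real.log ((n : ℝ) + 2) := one_div_pos.2 (hlog n)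
  have h3 : 1 / Real.log 2 ≤ 2 := by
    rw [div_le_iff₀ (Real.log_pos one_lt_two)]
    linarith [Real.log_two_gt_d9]
  linarith

theorem sum_Icc_inv_mul_succ_le (n : ℕ) :
    ∑ b ∈ Icc 1 n, 1 / ((b : ℝ) * (b + 1)) ≤ 1 := by
  have key : ∑ b ∈ Icc 1 n, 1 / ((b : ℝ) * (b + 1)) = 1 - 1 / ((n : ℝ) + 1) := by
    induction n with
    | zero => simp
    | succ n ih =>
      rw [Finset.sum_Icc_succ_top (by omega), ih]
      push_cast
      field_simp
      ring
  rw [key]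
  have : 0 < 1 / ((n : ℝ) + 1) := by positivity
  linarith

/-- Markov's inequality for finitely many random variables, with a union bound. -/
theorem card_mul_one_sub_le_card_filter {Ω ι : Type*} [DecidableEq Ω] (T : Finset Ω)
    (I : Finset ι) (X : ι → Ω → ℝ) (lam τ : ι → ℝ) [DecidablePred fun ω => ∀ i ∈ I, X i ω ≤ lam i]
    (hX : ∀ i ∈ I, ∀ ω, 0 ≤ X i ω) (hlam : ∀ i ∈ I, 0 < lam i)
    (hsum : ∀ i ∈ I, ∑ ω ∈ T, X i ω ≤ #T * (lam i * τ i)) :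
    (#T : ℝ) * (1 - ∑ i ∈ I, τ i) ≤ #{ω ∈ T | ∀ i ∈ I, X i ω ≤ lam i} := by
  classical
  have hsub : T ⊆ {ω ∈ T | ∀ i ∈ I, X i ω ≤ lam i} ∪ I.biUnion fun i => {ω ∈ T | lam i < X i ω} := by
    intro ω hω
    by_cases h : ∀ i ∈ I, X i ω ≤ lam i
    · exact Finset.mem_union_left _ (Finset.mem_filter.2 ⟨hω, h⟩)
    · push Not at h
      obtain ⟨i, hi, hlt⟩ := h
      exact Finset.mem_union_right _
        (Finset.mem_biUnion.2 ⟨i, hi, Finset.mem_filter.2 ⟨hω, hlt⟩⟩)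
  have hcard : #T ≤ #{ω ∈ T | ∀ i ∈ I, X i ω ≤ lam i} + ∑ i ∈ I, #{ω ∈ T | lam i < X i ω} :=
    (Finset.card_le_card hsub).trans ((Finset.card_union_le _ _).trans
      (Nat.add_le_add_left Finset.card_biUnion_le _))
  have hcard' : (#T : ℝ) ≤ #{ω ∈ T | ∀ i ∈ I, X i ω ≤ lam i} +
      ∑ i ∈ I, (#{ω ∈ T | lam i < X i ω} : ℝ) := by exact_mod_cast hcard
  have hbad : ∀ i ∈ I, (#{ω ∈ T | lam i < X i ω} : ℝ) ≤ #T * τ i := by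
    intro i hi
    have h1 : (#{ω ∈ T | lam i < X i ω} : ℝ) * lam i ≤ ∑ ω ∈ T, X i ω := by
      calc _ = ∑ ω ∈ T with lam i < X i ω, lam i := by rw [Finset.sum_const, nsmul_eq_mul]
        _ ≤ ∑ ω ∈ T with lam i < X i ω, X i ω :=
          Finset.sum_le_sum fun ω hω => (Finset.mem_filter.1 hω).2.le
        _ ≤ _ := Finset.sum_le_sum_of_subset_of_nonneg (Finset.filter_subset _ _)
          fun ω _ _ => hX i hi ω
    have h2 := h1.trans (hsum i hi)
    have h3 : (#{ω ∈ T | lam i < X i ω} : ℝ) * lam i ≤ #T * τ i * lam i := by linarith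
    exact le_of_mul_le_mul_right h3 (hlam i hi)
  have := Finset.sum_le_sum hbad
  rw [← Finset.mul_sum] at this
  linarith

/-- Rewrites the Markov threshold at scale `m` in terms of `N`. The square root yields `(m + 1)^(s +
2) √(m + 3) log (m + 3)`, hence the exponent `s + 5 / 2`. There is slack elsewhere: `ε^(-1/2)` would
do for `ε⁻¹`, and the first power of the iterated logarithm for the power `5 / 2`. -/
theorem scale_bound_le {s m N : ℕ} (hN : 2 ^ m ≤ N) {ε C : ℝ} (hε : 0 < ε)
    (hε1 : ε < 1) (hC : 0 ≤ C) :
    (6 * s + √(4 * C * ((m : ℝ) + 1) ^ (2 * s + 4) * ((m + 3) * Real.log (m + 3) ^ 2) / ε)) / √N ≤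
      ε⁻¹ * (6 * s + 2 * 3 ^ (s + 3) * √C) * (N : ℝ) ^ (-(1 / 2) : ℝ) *
        Real.log (6 * (N : ℝ)) ^ ((s : ℝ) + 5 / 2) *
        Real.log (3 * Real.log (6 * (N : ℝ))) ^ (5 / 2 : ℝ) := by
  have hN0 : 1 ≤ N := le_trans Nat.one_le_two_pow hN
  have hN0' : (0 : ℝ) < N := by exact_mod_cast hN0
  have hm0 : (0 : ℝ) ≤ m := Nat.cast_nonneg m
  set l := Real.log (6 * (N : ℝ)) with hl
  have hl2 := Real.log_two_gt_d9
  -- From `6 N ≥ 4 * 2 ^ m` and `log 2 ≥ 2 / 3`.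
  have hlm : 2 * (m : ℝ) + 4 ≤ 3 * l := by
    have h1 : Real.log (4 * 2 ^ m) ≤ l := by
      apply Real.log_le_log (by positivity)
      have : (2 : ℝ) ^ m ≤ N := by exact_mod_cast hN
      linarith
    rw [Real.log_mul (by norm_num) (by positivity), Real.log_pow,
      show (4 : ℝ) = 2 ^ 2 by norm_num, Real.log_pow] at h1
    push_cast at h1
    nlinarith
  have hl1 : 1 ≤ l := by linarith
  set ll := Real.log (3 * l) with hll
  -- The inner factor `3` is what makes this hold: `3 l ≥ 3 > e`.
  have hll1 : 1 ≤ ll := by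
    rw [hll, Real.le_log_iff_exp_le (by linarith)]
    linarith [Real.exp_one_lt_d9]
  have hlog3 : Real.log (m + 3) ≤ ll := by
    have : (3 : ℝ) ≤ 3 * l := by linarith
    apply Real.log_le_log (by positivity)
    by_cases h : (1 : ℝ) ≤ m
    · linarith
    · linarith
  have hlog0 : 0 ≤ Real.log ((m : ℝ) + 3) := Real.log_nonneg (by linarith)
  set B := l ^ ((s : ℝ) + 5 / 2) * ll ^ (5 / 2 : ℝ) with hB
  have hlB : 1 ≤ l ^ ((s : ℝ) + 5 / 2) := Real.one_le_rpow hl1 (by positivity)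
  have hllB : 1 ≤ ll ^ (5 / 2 : ℝ) := Real.one_le_rpow hll1 (by positivity)
  have hB1 : 1 ≤ B := one_le_mul_of_one_le_of_one_le hlB hllB
  have hεi : 1 ≤ ε⁻¹ := (one_le_inv₀ hε).2 hε1.le
  have hsqrt : √(4 * C * ((m : ℝ) + 1) ^ (2 * s + 4) * ((m + 3) * Real.log (m + 3) ^ 2) / ε) ≤
      ε⁻¹ * (2 * √C * (((m : ℝ) + 1) ^ (s + 2) * √((m : ℝ) + 3) * Real.log (m + 3))) := by
    rw [Real.sqrt_le_left (by positivity)]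
    have e : (ε⁻¹ * (2 * √C * (((m : ℝ) + 1) ^ (s + 2) * √((m : ℝ) + 3) * Real.log (m + 3)))) ^ 2 =
        ε⁻¹ * (ε⁻¹ * (4 * √C ^ 2 * ((m : ℝ) + 1) ^ (2 * s + 4) *
          (√((m : ℝ) + 3) ^ 2 * Real.log (m + 3) ^ 2))) := by ring
    rw [e, Real.sq_sqrt hC, Real.sq_sqrt (by positivity), div_eq_inv_mul]
    apply le_mul_of_one_le_left (by positivity) hεi
  have hpow : ((m : ℝ) + 1) ^ (s + 2) * √((m : ℝ) + 3) ≤ 3 ^ (s + 3) * l ^ ((s : ℝ) + 5 / 2) := by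
    have h1 : l ^ ((s : ℝ) + 5 / 2) = l ^ (s + 2) * √l := by
      rw [Real.sqrt_eq_rpow, ← Real.rpow_natCast, ← Real.rpow_add (by linarith)]
      congr 1
      push_cast
      ring
    have h2 : √((m : ℝ) + 3) ≤ 3 * √l := by
      rw [Real.sqrt_le_left (by positivity), mul_pow, Real.sq_sqrt (by linarith)]
      linarith
    rw [h1]
    calc ((m : ℝ) + 1) ^ (s + 2) * √((m : ℝ) + 3) ≤ (3 * l) ^ (s + 2) * (3 * √l) := by
          gcongr
          linarith
      _ = _ := by ring
  have hmain : ((m : ℝ) + 1) ^ (s + 2) * √((m : ℝ) + 3) * Real.log (m + 3) ≤ 3 ^ (s + 3) * B := by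
    have h1 : Real.log ((m : ℝ) + 3) ≤ ll ^ (5 / 2 : ℝ) :=
      hlog3.trans (Real.self_le_rpow_of_one_le hll1 (by norm_num))
    calc _ ≤ 3 ^ (s + 3) * l ^ ((s : ℝ) + 5 / 2) * ll ^ (5 / 2 : ℝ) := by gcongr
      _ = _ := by rw [hB]; ring
  have hNpow : (N : ℝ) ^ (-(1 / 2) : ℝ) = 1 / √N := by
    rw [Real.rpow_neg hN0'.le, Real.sqrt_eq_rpow, one_div (_ ^ _)]
  have hfinal : 6 * s + √(4 * C * ((m : ℝ) + 1) ^ (2 * s + 4) *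
      ((m + 3) * Real.log (m + 3) ^ 2) / ε) ≤ ε⁻¹ * (6 * s + 2 * 3 ^ (s + 3) * √C) * B := by
    have h1 : (6 * s : ℝ) ≤ ε⁻¹ * (6 * s) * B := by
      have h2 : (1 : ℝ) ≤ ε⁻¹ * B := one_le_mul_of_one_le_of_one_le hεi hB1
      have h3 : (6 * s : ℝ) ≤ (6 * s) * (ε⁻¹ * B) := le_mul_of_one_le_right (by positivity) h2
      linarith
    have h4 : ε⁻¹ * (2 * √C * (((m : ℝ) + 1) ^ (s + 2) * √((m : ℝ) + 3) * Real.log (m + 3))) ≤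
        ε⁻¹ * (2 * √C * (3 ^ (s + 3) * B)) := by gcongr
    linarith
  calc _ ≤ ε⁻¹ * (6 * s + 2 * 3 ^ (s + 3) * √C) * B / √N := by gcongr
    _ = _ := by rw [hNpow, hB]; ring

/-! ### Union bound over all scales and all `b₁, b₂` -/

theorem theorem1 (s : ℕ) (hs : 1 ≤ s) :
    ∃ c : ℕ → ℕ → ℝ,
      ∀ (p : ℕ) [Fact p.Prime] (k : ℕ), 2 ≤ k →
      ∀ (F : Type*) [Field F] [Fintype F] [Algebra (ZMod p) F], Fintype.card F = p ^ k →
      ∀ ε : ℝ, 0 < ε → ε < 1 →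
        (1 - ε) * ((p ^ k : ℕ) : ℝ) * (Nat.totient (p ^ k - 1) : ℝ) <
          (Set.ncard {ab : F × F | IsPrimitiveRoot ab.2 (p ^ k - 1) ∧
            ∀ N ∈ Set.Icc 1 (p ^ k), ∀ b₁ ∈ Set.Icc 1 (p ^ k), ∀ b₂ ∈ Set.Icc 1 (p ^ k),
              discrepancy
                (fun n => overlappingTuple s (multistep p k (shiftRegister p ab.1 ab.2))
                  (b₁ * n + b₂)) N ≤
                ε⁻¹ * c b₁ b₂ * (N : ℝ) ^ (-(1 / 2) : ℝ) *
                  Real.log (6 * (N : ℝ)) ^ ((s : ℝ) + 5 / 2) *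
                  Real.log (3 * Real.log (6 * (N : ℝ))) ^ (5 / 2 : ℝ)} : ℝ) := by
  set A : ℕ → ℝ := fun b₁ => 66 * 49 ^ s * b₁ * s with hA
  -- The reciprocals of `g` sum to at most `1`, which pays for the union over `b₁` and `b₂`.
  set g : ℕ → ℝ := fun b => (b : ℝ) * (b + 1) with hg
  refine ⟨fun b₁ b₂ => 6 * s + 2 * 3 ^ (s + 3) * √(A b₁ * (g b₁ * g b₂)), ?_⟩
  intro p _ k hk F _ _ _ hF ε hε hε1
  classical
  set q := p ^ k with hq
  have hp2 : 2 ≤ p := (Fact.out : p.Prime).two_le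
  have hq2 : 2 ≤ q := by
    calc 2 ≤ p := hp2
      _ = p ^ 1 := (pow_one p).symm
      _ ≤ p ^ k := Nat.pow_le_pow_right (by omega) (by omega)
  have hφ : 0 < Nat.totient (q - 1) := Nat.totient_pos.2 (by omega)
  set I : Finset (ℕ × ℕ × ℕ) := range (Nat.log 2 q + 1) ×ˢ (Icc 1 q ×ˢ Icc 1 q) with hI
  have hI' : ∀ i ∈ I, 2 ^ i.1 ≤ q ∧ 1 ≤ i.2.1 ∧ 1 ≤ i.2.2 := by
    rintro ⟨m, b₁, b₂⟩ hi
    simp only [hI, Finset.mem_product, Finset.mem_range, Finset.mem_Icc] at hi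
    exact ⟨Nat.pow_le_of_le_log (by omega) (by omega), hi.2.1.1, hi.2.2.1⟩
  -- Membership in `I` is placed inside the existential so that `choose` yields a total family;
  -- outside `I` the value is irrelevant.
  have hex : ∀ i : ℕ × ℕ × ℕ, ∃ X : F → F → ℝ, i ∈ I → (∀ α β, 0 ≤ X α β) ∧
      (∀ α β N, 2 ^ i.1 ≤ N → N < 2 ^ (i.1 + 1) →
        discrepancy (fun n => overlappingTuple s (multistep p k (shiftRegister p α β))
          (i.2.1 * n + i.2.2)) N ≤ (6 * s + √(X α β)) / √N) ∧
      ∑ β ∈ primitiveRoots (q - 1) F, ∑ α, X α β ≤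
        (q : ℝ) * Nat.totient (q - 1) * (A i.2.1 * ((i.1 : ℝ) + 1) ^ (2 * s + 4)) := by
    intro i
    by_cases hi : i ∈ I
    · obtain ⟨h1, h2, -⟩ := hI' i hi
      obtain ⟨X, hX⟩ := exists_discrepancy_majorant (F := F) hF (by omega) hs h1 h2 i.2.2
      exact ⟨X, fun _ => hX⟩
    · exact ⟨0, fun h => absurd h hi⟩
  choose X hX using hex
  set T : Finset (F × F) := univ ×ˢ primitiveRoots (q - 1) F with hT
  have hTcard : (#T : ℝ) = (q : ℝ) * Nat.totient (q - 1) := by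
    have := card_primitiveRoots_card_sub_one F
    rw [hF] at this
    rw [hT, Finset.card_product, this, Finset.card_univ, hF]
    push_cast
    ring
  set σ : ℕ → ℝ := fun m => ((m : ℝ) + 3) * Real.log (m + 3) ^ 2 with hσ
  have hσ0 : ∀ m, 0 < σ m := fun m => by
    have : 0 < Real.log ((m : ℝ) + 3) := Real.log_pos (by linarith [(Nat.cast_nonneg (α := ℝ) m)])
    positivity
  -- Chosen so that `lam i * τ i` is exactly the mean bound `A * (m + 1)^(2 s + 4)` for `i = (m, b₁,
  -- b₂)`.
  set lam : ℕ × ℕ × ℕ → ℝ := fun i =>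
    4 * (A i.2.1 * (g i.2.1 * g i.2.2)) * ((i.1 : ℝ) + 1) ^ (2 * s + 4) * σ i.1 / ε with hlam
  set τ : ℕ × ℕ × ℕ → ℝ := fun i =>
    ε / 4 * (1 / σ i.1 * (1 / g i.2.1 * (1 / g i.2.2))) with hτ
  have hs0 : (0 : ℝ) < s := by exact_mod_cast hs
  have hg0 : ∀ b, 1 ≤ b → 0 < g b := fun b hb => by
    have : (0 : ℝ) < b := by exact_mod_cast hb
    positivity
  have hA0 : ∀ b, 1 ≤ b → 0 < A b := fun b hb => by
    have : (0 : ℝ) < b := by exact_mod_cast hb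
    positivity
  have hτsum : ∑ i ∈ I, τ i ≤ ε / 2 := by
    have h1 := sum_range_inv_mul_log_sq_le (Nat.log 2 q + 1)
    have h2 := sum_Icc_inv_mul_succ_le q
    have hn : 0 ≤ ∑ b ∈ Icc 1 q, 1 / ((b : ℝ) * (b + 1)) :=
      Finset.sum_nonneg fun b _ => by positivity
    have e : ∑ i ∈ I, τ i = ε / 4 * ((∑ m ∈ range (Nat.log 2 q + 1), 1 / σ m) *
        ((∑ b ∈ Icc 1 q, 1 / g b) * ∑ b ∈ Icc 1 q, 1 / g b)) := by
      rw [hI, hτ, ← Finset.mul_sum, Finset.sum_product, Finset.sum_mul]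
      congr 1
      refine Finset.sum_congr rfl fun m _ => ?_
      rw [Finset.sum_product, Finset.sum_mul_sum, Finset.mul_sum]
      refine Finset.sum_congr rfl fun b _ => ?_
      rw [Finset.mul_sum]
    rw [e]
    calc _ ≤ ε / 4 * (2 * (1 * 1)) := by
          gcongr
      _ = ε / 2 := by ring
  have hmarkov := card_mul_one_sub_le_card_filter T I (fun i ω => X i ω.1 ω.2) lam τ
    (fun i hi ω => (hX i hi).1 _ _)
    (fun i hi => by
      obtain ⟨-, h1, h2⟩ := hI' i hi
      have := hg0 _ h1
      have := hg0 _ h2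
      have := hA0 _ h1
      have := hσ0 i.1
      positivity)
    (fun i hi => by
      obtain ⟨-, h1, h2⟩ := hI' i hi
      have e1 := (hg0 _ h1).ne'
      have e2 := (hg0 _ h2).ne'
      have e3 := (hσ0 i.1).ne'
      rw [hT, Finset.sum_product_right, ← hT, hTcard]
      refine (hX i hi).2.2.trans (le_of_eq ?_)
      simp only [hlam, hτ]
      field_simp)
  rw [hTcard] at hmarkov
  -- The failure probabilities total at most `ε / 2`, strictly less than `ε`; this yields the strict
  -- inequality.
  have hstrict : (1 - ε) * (q : ℝ) * Nat.totient (q - 1) <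
      (q : ℝ) * Nat.totient (q - 1) * (1 - ∑ i ∈ I, τ i) := by
    have hpos : (0 : ℝ) < (q : ℝ) * Nat.totient (q - 1) := by
      have h1 : (0 : ℝ) < q := by exact_mod_cast (by omega : 0 < q)
      have h2 : (0 : ℝ) < Nat.totient (q - 1) := by exact_mod_cast hφ
      positivity
    nlinarith
  refine hstrict.trans_le (hmarkov.trans ?_)
  rw [Nat.cast_le, ← Set.ncard_coe_finset]
  refine Set.ncard_le_ncard ?_ (Set.toFinite _)
  rintro ⟨α, β⟩ hω
  rw [Finset.mem_coe, Finset.mem_filter, hT, Finset.mem_product,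
    mem_primitiveRoots (by omega)] at hω
  refine ⟨hω.1.2, fun N hN b₁ hb₁ b₂ hb₂ => ?_⟩
  set m := Nat.log 2 N with hm
  have hN1 : 2 ^ m ≤ N := Nat.pow_log_le_self 2 (by have := hN.1; omega)
  have hN2 : N < 2 ^ (m + 1) := Nat.lt_pow_succ_log_self one_lt_two N
  have hi : (m, b₁, b₂) ∈ I := by
    simp only [hI, Finset.mem_product, Finset.mem_range, Finset.mem_Icc]
    exact ⟨Nat.lt_succ_of_le (Nat.log_mono_right hN.2), hb₁, hb₂⟩
  have hle := hω.2 _ hi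
  refine ((hX _ hi).2.1 α β N hN1 hN2).trans (le_trans ?_
    (scale_bound_le (s := s) (C := A b₁ * (g b₁ * g b₂)) hN1 hε hε1
      (mul_nonneg (hA0 _ hb₁.1).le (mul_nonneg (hg0 _ hb₁.1).le (hg0 _ hb₂.1).le))))
  gcongr

end
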